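/- Let $(M,g_M)$ and $(N,g_N)$ be smooth Riemannian manifolds with $\dim N>2$, and let $\nabla$ be the Levi-Civita connection of $g_M$. Let $(I,J,K,g_M)$ be a hyperkähler structure on $M$: $I,J,K$ are smooth sections of $\mathrm{End}(TM)$ with $I^2=J^2=K^2=-\mathrm{id}$, $IJ=-JI=K$, $g_M(RX,RY)=g_M(X,Y)$ and $\nabla R=0$ for $R\in\{I,J,K\}$. Let $F:M\to N$ be a horizontally conformal submersion with dilation $\lambda:M\to(0,\infty)$, i.e. $F$ is smooth, each differential $(F_*)_p$ is surjective, and $g_N(F_*X,F_*Y)=\lambda(p)^2g_M(X,Y)$ for all $X,Y\in(\ker (F_*)_p)^\perp$, $p\in M$. Suppose that $F$ is an almost h-conformal slant submersion with almost h-conformal slant basis $(I,J,K)$ and slant angles $\theta_I,\theta_J,\theta_K$: for each $R\in\{I,J,K\}$, all $p\in M$ and all nonzero $X\in\ker(F_*)_p$, the angle between $RX$ and the subspace $\ker(F_*)_p$ equals the constant $\theta_R$. Let $\mathcal V$ and $\mathcal H$ denote the orthogonal projections of $TM$ onto $\ker F_*$ and $(\ker F_*)^\perp$, and for $V\in\Gamma(\ker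 F_*)$ put $\omega_RV=\mathcal H(RV)$. Call $\omega_R$ parallel if $$(\nabla_V\omega_R)(W):=\mathcal H\nabla_V(\omega_RW)-\omega_R(\mathcal V\nabla_VW)=0\qquad\text{for all (local) smooth sections }V,W\text{ of }\ker F_*.$$ Assume that for some $R\in\{I,J,K\}$ the tensor $\omega_R$ is parallel and $0\le\theta_R<\frac{\pi}{2}$. Then the following are equivalent: (a) $F$ is harmonic, i.e. its tension field $\tau(F)=\operatorname{trace}(\nabla F_*)$ vanishes, where $(\nabla F_*)(X,Y)=\nabla^F_XF_*Y-F_*(\nabla_XY)$ and $\nabla^F$ is the pullback along $F$ of the Levi-Civita connection of $g_N$; (b) $F$ is horizontally homothetic, i.e. the gradient of $\lambda$ is vertical: $\mathcal H(\operatorname{grad}\lambda)=0$ on $M$. -/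

import Mathlib

open Bundle Manifold ContDiff Topology

set_option linter.unusedSectionVars false

noncomputable section

namespace HSlant

/-! ### The Levi-Civita connection of a Riemannian manifold, built from the Koszul formula -/

section LeviCivita

variable {E : Type*} [NormedAddCommGroup E] [NormedSpace ℝ E]
  {H : Type*} [TopologicalSpace H] (I : ModelWithCorners ℝ E H)
  {M : Type*} [TopologicalSpace M] [ChartedSpace H M]
  [RiemannianBundle (fun x : M ↦ TangentSpace I x)]

/-- The function `g(X, Y)` for two vector fields `X`, `Y`. -/
def metricFun (X Y : Π x : M, TangentSpace I x) (x : M) : ℝ := inner ℝ (X x) (Y x)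

/-- The right-hand side of the Koszul formula, which computes `g(∇_X Y, Z)` at `x`. -/
def koszul (X Y Z : Π x : M, TangentSpace I x) (x : M) : ℝ :=
  (1 / 2 : ℝ) *
    (mvfderiv I (metricFun I Y Z) x (X x) + mvfderiv I (metricFun I Z X) x (Y x)
      - mvfderiv I (metricFun I X Y) x (Z x)
      + inner ℝ (VectorField.mlieBracket I X Y x) (Z x)
      - inner ℝ (VectorField.mlieBracket I Y Z x) (X x)
      + inner ℝ (VectorField.mlieBracket I Z X x) (Y x))

variable {I}

lemma metricFun_comm (X Y : Π x : M, TangentSpace I x) : metricFun I X Y = metricFun I Y X :=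
  funext fun _ ↦ real_inner_comm _ _

lemma metricFun_add (X Y Z : Π x : M, TangentSpace I x) :
    metricFun I X (Y + Z) = metricFun I X Y + metricFun I X Z :=
  funext fun _ ↦ inner_add_right _ _ _

lemma metricFun_smul (f : M → ℝ) (X Y : Π x : M, TangentSpace I x) :
    metricFun I X (f • Y) = f * metricFun I X Y :=
  funext fun _ ↦ real_inner_smul_right _ _ _

lemma koszul_metric {X Y Z : Π x : M, TangentSpace I x} {x : M} :
    koszul I X Y Z x + koszul I X Z Y x = mvfderiv I (metricFun I Y Z) x (X x) := by
  rw [koszul, koszul, metricFun_comm Z Y, metricFun_comm X Y, metricFun_comm Z X,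
    VectorField.mlieBracket_swap_apply (V := Z) (W := Y),
    VectorField.mlieBracket_swap_apply (V := X) (W := Y),
    VectorField.mlieBracket_swap_apply (V := X) (W := Z)]
  simp only [inner_neg_left]
  ring

lemma koszul_torsion {X Y Z : Π x : M, TangentSpace I x} {x : M} :
    koszul I X Y Z x - koszul I Y X Z x = inner ℝ (VectorField.mlieBracket I X Y x) (Z x) := by
  rw [koszul, koszul, metricFun_comm X Z, metricFun_comm Z Y, metricFun_comm X Y,
    VectorField.mlieBracket_swap_apply (V := Y) (W := X),
    VectorField.mlieBracket_swap_apply (V := X) (W := Z),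
    VectorField.mlieBracket_swap_apply (V := Z) (W := Y)]
  simp only [inner_neg_left]
  ring

variable [IsManifold I ∞ M] [IsContMDiffRiemannianBundle I ∞ E (fun x : M ↦ TangentSpace I x)]

lemma mdiffAt_metricFun {X Y : Π x : M, TangentSpace I x} {x : M}
    (hX : MDiffAt (T% X) x) (hY : MDiffAt (T% Y) x) : MDiffAt (metricFun I X Y) x :=
  MDifferentiableAt.inner_bundle (E := fun x : M ↦ TangentSpace I x) (b := fun x ↦ x) hX hY

variable [FiniteDimensional ℝ E]

lemma koszul_add_right {X Y Z Z' : Π x : M, TangentSpace I x} {x : M}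
    (hX : MDiffAt (T% X) x) (hY : MDiffAt (T% Y) x) (hZ : MDiffAt (T% Z) x)
    (hZ' : MDiffAt (T% Z') x) :
    koszul I X Y (Z + Z') x = koszul I X Y Z x + koszul I X Y Z' x := by
  rw [koszul, metricFun_comm _ X, metricFun_add, metricFun_add,
    mvfderiv_add (mdiffAt_metricFun hY hZ) (mdiffAt_metricFun hY hZ'),
    mvfderiv_add (mdiffAt_metricFun hX hZ) (mdiffAt_metricFun hX hZ'),
    VectorField.mlieBracket_add_right hZ hZ', VectorField.mlieBracket_add_left hZ hZ',
    metricFun_comm X Z, metricFun_comm X Z', koszul, koszul]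
  simp only [Pi.add_apply, add_apply, map_add, inner_add_left, inner_add_right]
  ring

lemma koszul_smul_right {X Y Z : Π x : M, TangentSpace I x} {f : M → ℝ} {x : M}
    (hX : MDiffAt (T% X) x) (hY : MDiffAt (T% Y) x) (hZ : MDiffAt (T% Z) x)
    (hf : MDiffAt f x) :
    koszul I X Y (f • Z) x = f x * koszul I X Y Z x := by
  rw [koszul, metricFun_comm _ X, metricFun_smul, metricFun_smul,
    mvfderiv_mul hf (mdiffAt_metricFun hY hZ),
    mvfderiv_mul hf (mdiffAt_metricFun hX hZ),
    VectorField.mlieBracket_smul_right hf hZ, VectorField.mlieBracket_smul_left hf hZ,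
    metricFun_comm X Z, koszul]
  simp [metricFun, inner_add_left, inner_smul_left, inner_smul_right, real_inner_comm]
  ring

lemma koszul_add_mid {X Y Y' Z : Π x : M, TangentSpace I x} {x : M}
    (hX : MDiffAt (T% X) x) (hY : MDiffAt (T% Y) x) (hY' : MDiffAt (T% Y') x)
    (hZ : MDiffAt (T% Z) x) :
    koszul I X (Y + Y') Z x = koszul I X Y Z x + koszul I X Y' Z x := by
  have h := koszul_metric (X := X) (Y := Y + Y') (Z := Z) (x := x)
  rw [koszul_add_right hX hZ hY hY', metricFun_comm, metricFun_add,
    mvfderiv_add (mdiffAt_metricFun hZ hY) (mdiffAt_metricFun hZ hY')] at h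
  have h1 := koszul_metric (X := X) (Y := Y) (Z := Z) (x := x)
  have h2 := koszul_metric (X := X) (Y := Y') (Z := Z) (x := x)
  rw [metricFun_comm] at h1 h2
  simp only [add_apply] at h
  linarith

lemma koszul_smul_mid {X Y Z : Π x : M, TangentSpace I x} {f : M → ℝ} {x : M}
    (hX : MDiffAt (T% X) x) (hY : MDiffAt (T% Y) x) (hZ : MDiffAt (T% Z) x)
    (hf : MDiffAt f x) :
    koszul I X (f • Y) Z x
      = f x * koszul I X Y Z x + mvfderiv I f x (X x) * inner ℝ (Y x) (Z x) := by
  have h := koszul_metric (X := X) (Y := f • Y) (Z := Z) (x := x)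
  rw [koszul_smul_right hX hZ hY hf, metricFun_comm, metricFun_smul,
    mvfderiv_mul hf (mdiffAt_metricFun hZ hY)] at h
  have h1 := koszul_metric (X := X) (Y := Y) (Z := Z) (x := x)
  rw [metricFun_comm] at h1
  simp only [add_apply, smul_apply, smul_eq_mul, metricFun,
    real_inner_comm] at h h1
  rw [← h1] at h
  linarith

lemma koszul_add_left {X X' Y Z : Π x : M, TangentSpace I x} {x : M}
    (hX : MDiffAt (T% X) x) (hX' : MDiffAt (T% X') x) (hY : MDiffAt (T% Y) x)
    (hZ : MDiffAt (T% Z) x) :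
    koszul I (X + X') Y Z x = koszul I X Y Z x + koszul I X' Y Z x := by
  have h := koszul_torsion (X := X + X') (Y := Y) (Z := Z) (x := x)
  rw [koszul_add_mid hY hX hX' hZ, VectorField.mlieBracket_add_left hX hX', inner_add_left] at h
  have h1 := koszul_torsion (X := X) (Y := Y) (Z := Z) (x := x)
  have h2 := koszul_torsion (X := X') (Y := Y) (Z := Z) (x := x)
  linarith

lemma koszul_smul_left {X Y Z : Π x : M, TangentSpace I x} {f : M → ℝ} {x : M}
    (hX : MDiffAt (T% X) x) (hY : MDiffAt (T% Y) x) (hZ : MDiffAt (T% Z) x)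
    (hf : MDiffAt f x) :
    koszul I (f • X) Y Z x = f x * koszul I X Y Z x := by
  have h := koszul_torsion (X := f • X) (Y := Y) (Z := Z) (x := x)
  rw [koszul_smul_mid hY hX hZ hf, VectorField.mlieBracket_smul_left hf hX, inner_add_left,
    real_inner_smul_left, real_inner_smul_left] at h
  have h1 := koszul_torsion (X := X) (Y := Y) (Z := Z) (x := x)
  rw [← h1] at h
  linarith

instance finiteDimensional_tangentSpace (x : M) : FiniteDimensional ℝ (TangentSpace I x) :=
  inferInstanceAs (FiniteDimensional ℝ E)

instance completeSpace_tangentSpace (x : M) : CompleteSpace (TangentSpace I x) :=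
  FiniteDimensional.complete ℝ _

variable (I) in
/-- The bilinear form `(v, w) ↦ g(∇_v Y, w)` on `T_x M`, for a vector field `Y` differentiable
at `x`: it is given by the Koszul formula, which is tensorial in its first and third arguments. -/
def koszulForm (Y : Π x : M, TangentSpace I x) (x : M) (hY : MDiffAt (T% Y) x) :
    TangentSpace I x →L[ℝ] TangentSpace I x →L[ℝ] ℝ :=
  TensorialAt.mkHom₂ (I := I) (F := E) (F' := E)
    (V := fun x : M ↦ TangentSpace I x) (V' := fun x : M ↦ TangentSpace I x)
    (fun X Z ↦ koszul I X Y Z x) x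
    (fun _ hZ ↦ ⟨fun hf hX ↦ koszul_smul_left hX hY hZ hf,
      fun hX hX' ↦ koszul_add_left hX hX' hY hZ⟩)
    (fun _ hX ↦ ⟨fun hf hZ ↦ koszul_smul_right hX hY hZ hf,
      fun hZ hZ' ↦ koszul_add_right hX hY hZ hZ'⟩)

lemma koszulForm_apply {X Y Z : Π x : M, TangentSpace I x} {x : M}
    (hX : MDiffAt (T% X) x) (hY : MDiffAt (T% Y) x) (hZ : MDiffAt (T% Z) x) :
    koszulForm I Y x hY (X x) (Z x) = koszul I X Y Z x :=
  TensorialAt.mkHom₂_apply _ _ hX hZ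

open scoped Classical in
variable (I) in
/-- The operator `v ↦ ∇_v Y` on `T_x M`, where `∇_v Y` is the vector that represents the linear form
`koszulForm Y x v`, that is, `g(∇_v Y, w) = koszulForm Y x v w` for all `w`. (At the points where
`Y` is not differentiable, the operator is zero by convention.) -/
def leviCivitaFun (Y : Π x : M, TangentSpace I x) (x : M) :
    TangentSpace I x →L[ℝ] TangentSpace I x :=
  if hY : MDiffAt (T% Y) x then
    LinearMap.toContinuousLinearMap
      { toFun := fun v ↦ (InnerProductSpace.toDual ℝ (TangentSpace I x)).symm (koszulForm I Y x hY v)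
        map_add' := fun v w ↦ by simp
        map_smul' := fun c v ↦ by simp }
  else 0

lemma inner_leviCivitaFun {X Y Z : Π x : M, TangentSpace I x} {x : M}
    (hX : MDiffAt (T% X) x) (hY : MDiffAt (T% Y) x) (hZ : MDiffAt (T% Z) x) :
    inner ℝ (leviCivitaFun I Y x (X x)) (Z x) = koszul I X Y Z x := by
  rw [leviCivitaFun, dif_pos hY, ← koszulForm_apply hX hY hZ]
  exact InnerProductSpace.toDual_symm_apply

/-- Two vectors of `T_x M` agree if they have the same inner product with the value at `x` of each
vector field that is differentiable at `x`. -/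
lemma ext_inner_field {x : M} {v w : TangentSpace I x}
    (h : ∀ Z : Π x : M, TangentSpace I x, MDiffAt (T% Z) x →
      inner ℝ v (Z x) = inner ℝ w (Z x)) : v = w := by
  refine ext_inner_right ℝ fun z ↦ ?_
  have := h (FiberBundle.extend E z) (FiberBundle.mdifferentiableAt_extend I E z)
  rwa [FiberBundle.extend_apply_self] at this

variable (I M) in
/-- The Levi-Civita connection of a Riemannian manifold. Beware of the order of the arguments:
`leviCivita I M Y x v` is `(∇_v Y)(x)`. -/
def leviCivita : CovariantDerivative I E (fun x : M ↦ TangentSpace I x) where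
  toFun := leviCivitaFun I
  isCovariantDerivativeOnUniv :=
    { add := fun {Y Y' x} hY hY' _ ↦ by
        ext v
        refine ext_inner_field fun Z hZ ↦ ?_
        have hX := FiberBundle.mdifferentiableAt_extend I E v
        rw [← FiberBundle.extend_apply_self E v,
          inner_leviCivitaFun hX (mdifferentiableAt_add_section hY hY') hZ, add_apply,
          inner_add_left, inner_leviCivitaFun hX hY hZ, inner_leviCivitaFun hX hY' hZ,
          koszul_add_mid hX hY hY' hZ]
      leibniz := fun {Y f x} hY hf _ ↦ by
        ext v
        refine ext_inner_field fun Z hZ ↦ ?_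
        have hX := FiberBundle.mdifferentiableAt_extend I E v
        rw [← FiberBundle.extend_apply_self E v,
          inner_leviCivitaFun hX (hf.smul_section hY) hZ, add_apply,
          inner_add_left, smul_apply, real_inner_smul_left, inner_leviCivitaFun hX hY hZ,
          koszul_smul_mid hX hY hZ hf, ContinuousLinearMap.smulRight_apply, real_inner_smul_left] }

/-- The Koszul formula. -/
theorem inner_leviCivita {X Y Z : Π x : M, TangentSpace I x} {x : M}
    (hX : MDiffAt (T% X) x) (hY : MDiffAt (T% Y) x) (hZ : MDiffAt (T% Z) x) :
    inner ℝ (leviCivita I M Y x (X x)) (Z x) = koszul I X Y Z x :=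
  inner_leviCivitaFun hX hY hZ

/-- The Levi-Civita connection is torsion-free. -/
theorem torsion_leviCivita : (leviCivita I M).torsion = 0 := by
  rw [CovariantDerivative.torsion_eq_zero_iff]
  intro X Y x hX hY
  refine ext_inner_field fun Z hZ ↦ ?_
  rw [inner_sub_left, inner_leviCivita hX hY hZ, inner_leviCivita hY hX hZ, koszul_torsion]

/-- The Levi-Civita connection is compatible with the metric. -/
theorem metric_leviCivita {X Y Z : Π x : M, TangentSpace I x} {x : M}
    (hX : MDiffAt (T% X) x) (hY : MDiffAt (T% Y) x) (hZ : MDiffAt (T% Z) x) :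
    mvfderiv I (metricFun I Y Z) x (X x)
      = inner ℝ (leviCivita I M Y x (X x)) (Z x) + inner ℝ (Y x) (leviCivita I M Z x (X x)) := by
  rw [inner_leviCivita hX hY hZ, real_inner_comm, inner_leviCivita hX hZ hY, koszul_metric]

end LeviCivita

/-! ### Riemannian notions attached to a map `F : M → N` -/

section Maps

variable {E : Type*} [NormedAddCommGroup E] [NormedSpace ℝ E] [FiniteDimensional ℝ E]
  {H : Type*} [TopologicalSpace H] (I : ModelWithCorners ℝ E H)
  {M : Type*} [TopologicalSpace M] [ChartedSpace H M] [IsManifold I ∞ M]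
  [RiemannianBundle (fun x : M ↦ TangentSpace I x)]
  [IsContMDiffRiemannianBundle I ∞ E (fun x : M ↦ TangentSpace I x)]
  {E' : Type*} [NormedAddCommGroup E'] [NormedSpace ℝ E'] [FiniteDimensional ℝ E']
  {H' : Type*} [TopologicalSpace H'] (I' : ModelWithCorners ℝ E' H')
  {N : Type*} [TopologicalSpace N] [ChartedSpace H' N] [IsManifold I' ∞ N]
  [RiemannianBundle (fun x : N ↦ TangentSpace I' x)]
  [IsContMDiffRiemannianBundle I' ∞ E' (fun x : N ↦ TangentSpace I' x)]

/-- The pullback connection `∇^F` of the Levi-Civita connection of `N`, applied to a section `s`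
of `F⁻¹TN` (a vector field along `F`) and a tangent vector `v` at `p`. In the local frame `(e_a)`
of `TN` given by the trivialization around `F p`, write `s = ∑ s^a (e_a ∘ F)`; then
`∇^F_v s = ∑ (v s^a) e_a + ∇_{F_* v} (∑ s^a(p) e_a)`. -/
def pullbackCov (F : M → N) (s : Π q : M, TangentSpace I' (F q)) (p : M) (v : TangentSpace I p) :
    TangentSpace I' (F p) :=
  (trivializationAt E' (fun y : N ↦ TangentSpace I' y) (F p)).symm (F p)
      (mvfderiv I (fun q : M ↦
        (trivializationAt E' (fun y : N ↦ TangentSpace I' y) (F p) ⟨F q, s q⟩).2) p v)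
    + leviCivita I' N (FiberBundle.extend E' (s p)) (F p) (mfderiv I I' F p v)

/-- The second fundamental form `(∇F_*)(X, Y) = ∇^F_X (F_* Y) - F_* (∇_X Y)`, at `p`. -/
def secondFundamentalForm (F : M → N) (X Y : Π x : M, TangentSpace I x) (p : M) :
    TangentSpace I' (F p) :=
  pullbackCov I I' F (fun q ↦ mfderiv I I' F q (Y q)) p (X p)
    - mfderiv I I' F p (leviCivita I M Y p (X p))

/-- The tension field `τ(F) = trace (∇F_*)`. The vectors of an orthonormal basis of `T_p M` are
extended to vector fields that are smooth near `p`; since `∇F_*` is tensorial, the choice of the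
extension does not matter. -/
def tensionField (F : M → N) (p : M) : TangentSpace I' (F p) :=
  ∑ i, secondFundamentalForm I I' F
    (FiberBundle.extend E (stdOrthonormalBasis ℝ (TangentSpace I p) i))
    (FiberBundle.extend E (stdOrthonormalBasis ℝ (TangentSpace I p) i)) p

/-- A map is harmonic if its tension field vanishes. -/
def IsHarmonic (F : M → N) : Prop := ∀ p, tensionField I I' F p = 0

/-- The vertical space `ker (F_*)_p`. Its orthogonal complement is the horizontal space. -/
def vertical (F : M → N) (p : M) : Submodule ℝ (TangentSpace I p) :=
  LinearMap.ker (mfderiv I I' F p : TangentSpace I p →ₗ[ℝ] TangentSpace I' (F p))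

/-- The orthogonal projection of `T_p M` onto the vertical space. -/
def verProj (F : M → N) (p : M) : TangentSpace I p →L[ℝ] TangentSpace I p :=
  (vertical I I' F p).starProjection

/-- The orthogonal projection of `T_p M` onto the horizontal space. -/
def horProj (F : M → N) (p : M) : TangentSpace I p →L[ℝ] TangentSpace I p :=
  (vertical I I' F p)ᗮ.starProjection

/-- `F` is a horizontally conformal submersion with dilation `lam`. -/
structure IsHorizontallyConformalSubmersion (F : M → N) (lam : M → ℝ) : Prop where
  smooth : ContMDiff I I' ∞ F
  surjective : ∀ p, Function.Surjective (mfderiv I I' F p)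
  dilation_pos : ∀ p, 0 < lam p
  conformal : ∀ p, ∀ X ∈ (vertical I I' F p)ᗮ, ∀ Y ∈ (vertical I I' F p)ᗮ,
    inner ℝ (mfderiv I I' F p X) (mfderiv I I' F p Y) = lam p ^ 2 * inner ℝ X Y

/-- The gradient of a function on `M`: `g(grad f, v) = df(v)`. -/
def grad (f : M → ℝ) (p : M) : TangentSpace I p :=
  (InnerProductSpace.toDual ℝ (TangentSpace I p)).symm (mvfderiv I f p)

/-- A horizontally conformal submersion with dilation `lam` is horizontally homothetic if the
gradient of `lam` is vertical. -/
def IsHorizontallyHomothetic (F : M → N) (lam : M → ℝ) : Prop :=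
  ∀ p, horProj I I' F p (grad I lam p) = 0

end Maps

/-! ### Hyperkähler structures and almost h-conformal slant submersions -/

section Slant

variable {E : Type*} [NormedAddCommGroup E] [NormedSpace ℝ E] [FiniteDimensional ℝ E]
  {H : Type*} [TopologicalSpace H] (I : ModelWithCorners ℝ E H)
  {M : Type*} [TopologicalSpace M] [ChartedSpace H M] [IsManifold I ∞ M]
  [RiemannianBundle (fun x : M ↦ TangentSpace I x)]
  [IsContMDiffRiemannianBundle I ∞ E (fun x : M ↦ TangentSpace I x)]
  {E' : Type*} [NormedAddCommGroup E'] [NormedSpace ℝ E'] [FiniteDimensional ℝ E']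
  {H' : Type*} [TopologicalSpace H'] (I' : ModelWithCorners ℝ E' H')
  {N : Type*} [TopologicalSpace N] [ChartedSpace H' N] [IsManifold I' ∞ N]
  [RiemannianBundle (fun x : N ↦ TangentSpace I' x)]
  [IsContMDiffRiemannianBundle I' ∞ E' (fun x : N ↦ TangentSpace I' x)]

/-- A hyperkähler structure on the Riemannian manifold `M`: smooth sections `I = R 0`, `J = R 1`,
`K = R 2` of `End(TM)` with `I² = J² = K² = -id` and `IJ = -JI = K`, which are isometries of the
metric and are parallel for the Levi-Civita connection, `∇_X (R Y) = R (∇_X Y)`. -/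
structure IsHyperkahler (R : Fin 3 → Π p : M, TangentSpace I p →L[ℝ] TangentSpace I p) :
    Prop where
  smooth : ∀ a, ContMDiff I (I.prod 𝓘(ℝ, E →L[ℝ] E)) ∞
    (fun p ↦ TotalSpace.mk' (E →L[ℝ] E)
      (E := fun p : M ↦ TangentSpace I p →L[ℝ] TangentSpace I p) p (R a p))
  sq : ∀ a p X, R a p (R a p X) = -X
  mul_eq : ∀ p X, R 0 p (R 1 p X) = R 2 p X
  mul_eq' : ∀ p X, R 1 p (R 0 p X) = -R 2 p X
  isometry : ∀ a p X Y, inner ℝ (R a p X) (R a p Y) = inner ℝ X Y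
  parallel : ∀ a (U : Set M), IsOpen U → ∀ Y : Π p : M, TangentSpace I p, CMDiff[U] ∞ (T% Y) →
    ∀ p ∈ U, ∀ v, leviCivita I M (fun q ↦ R a q (Y q)) p v = R a p (leviCivita I M Y p v)

/-- The angle between a vector and a subspace: the angle between the vector and its orthogonal
projection to the subspace (`π / 2` if the projection is zero). -/
def angleToSubspace {T : Type*} [NormedAddCommGroup T] [InnerProductSpace ℝ T]
    (K : Submodule ℝ T) [K.HasOrthogonalProjection] (v : T) : ℝ :=
  InnerProductGeometry.angle v (K.starProjection v)

/-- `F` is an almost h-conformal slant submersion with dilation `lam`, almost h-conformal slant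
basis `(I, J, K) = (R 0, R 1, R 2)` and slant angles `(θ_I, θ_J, θ_K) = (θ 0, θ 1, θ 2)`. -/
structure IsAlmostHConformalSlant (F : M → N) (lam : M → ℝ)
    (R : Fin 3 → Π p : M, TangentSpace I p →L[ℝ] TangentSpace I p) (θ : Fin 3 → ℝ) : Prop where
  conformal : IsHorizontallyConformalSubmersion I I' F lam
  slant : ∀ a p, ∀ X ∈ vertical I I' F p, X ≠ 0 →
    angleToSubspace (vertical I I' F p) (R a p X) = θ a

/-- `ω_R V`, the horizontal part of `R V` (for a vertical vector field `V`). -/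
def omega (F : M → N) (R : Π p : M, TangentSpace I p →L[ℝ] TangentSpace I p)
    (V : Π p : M, TangentSpace I p) (p : M) : TangentSpace I p :=
  horProj I I' F p (R p (V p))

/-- `V` is a smooth section of `ker F_*` over the set `U`. -/
def IsVerticalField (F : M → N) (U : Set M) (V : Π p : M, TangentSpace I p) : Prop :=
  CMDiff[U] ∞ (T% V) ∧ ∀ p ∈ U, V p ∈ vertical I I' F p

/-- `(∇_V ω_R)(W) = H ∇_V (ω_R W) - ω_R (V ∇_V W)`, where `H` and `V` are the horizontal and the
vertical projection. -/
def covOmega (F : M → N) (R : Π p : M, TangentSpace I p →L[ℝ] TangentSpace I p)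
    (V W : Π p : M, TangentSpace I p) (p : M) : TangentSpace I p :=
  horProj I I' F p (leviCivita I M (omega I I' F R W) p (V p))
    - omega I I' F R (fun q ↦ verProj I I' F q (leviCivita I M W q (V q))) p

/-- `ω_R` is parallel: `(∇_V ω_R)(W) = 0` for all (local) smooth sections `V`, `W` of `ker F_*`. -/
def OmegaParallel (F : M → N) (R : Π p : M, TangentSpace I p →L[ℝ] TangentSpace I p) : Prop :=
  ∀ U : Set M, IsOpen U → ∀ V W : Π p : M, TangentSpace I p,
    IsVerticalField I I' F U V → IsVerticalField I I' F U W →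
      ∀ p ∈ U, covOmega I I' F R V W p = 0

end Slant

end HSlant

end

noncomputable section

namespace HSlant

section Bracket

variable {E : Type*} [NormedAddCommGroup E] [NormedSpace ℝ E] [FiniteDimensional ℝ E]
  {H : Type*} [TopologicalSpace H] {I : ModelWithCorners ℝ E H} [I.Boundaryless]
  {M : Type*} [TopologicalSpace M] [ChartedSpace H M] [IsManifold I ∞ M]
  {G : Type*} [NormedAddCommGroup G] [NormedSpace ℝ G]

lemma contDiffAt_comp_extChartAt_symm {f : M → G} {p : M} {n : ℕ∞ω} (hf : CMDiffAt n f p) :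
    ContDiffAt ℝ n (f ∘ (extChartAt I p).symm) (extChartAt I p p) := by
  have := (contMDiffAt_iff.1 hf).2
  rwa [I.range_eq_univ, contDiffWithinAt_univ, extChartAt_model_space_eq_id,
    PartialEquiv.refl_coe, Function.id_comp] at this

/-- The representative of a vector field in the extended chart around `p`. -/
def chartField (I : ModelWithCorners ℝ E H) (p : M) (Y : Π x : M, TangentSpace I x) (x : E) : E :=
  VectorField.mpullbackWithin 𝓘(ℝ, E) I (extChartAt I p).symm Y (Set.range I) x

lemma differentiableAt_chartField {Y : Π x : M, TangentSpace I x} {p : M}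
    (hY : MDiffAt (T% Y) p) : DifferentiableAt ℝ (chartField I p Y) (extChartAt I p p) := by
  rw [← mdifferentiableWithinAt_univ] at hY
  have h : DifferentiableWithinAt ℝ (chartField I p Y) _ _ :=
    hY.differentiableWithinAt_mpullbackWithin_vectorField
  rwa [I.range_eq_univ, Set.preimage_univ, Set.inter_univ, differentiableWithinAt_univ] at h

lemma chartField_apply_self (Y : Π x : M, TangentSpace I x) (p : M) :
    chartField I p Y (extChartAt I p p) = Y p := by
  have h : (extChartAt I p).symm (extChartAt I p p) = p := extChartAt_to_inv p
  rw [chartField, VectorField.mpullbackWithin, mfderivWithin_range_extChartAt_symm]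
  have key (A : E →L[ℝ] E) (hA : A = ContinuousLinearMap.id ℝ E) (w : E) : A.inverse w = w := by
    rw [hA, ContinuousLinearMap.inverse_id, ContinuousLinearMap.id_apply]
  refine (key _ rfl _).trans ?_
  rw [h]

lemma mlieBracket_eq_chartField (X Y : Π x : M, TangentSpace I x) (p : M) :
    VectorField.mlieBracket I X Y p =
      fderiv ℝ (chartField I p Y) (extChartAt I p p) (X p)
        - fderiv ℝ (chartField I p X) (extChartAt I p p) (Y p) := by
  have key (A : E →L[ℝ] E) (hA : A = ContinuousLinearMap.id ℝ E) (w : E) : A.inverse w = w := by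
    rw [hA, ContinuousLinearMap.inverse_id, ContinuousLinearMap.id_apply]
  rw [← VectorField.mlieBracketWithin_univ, VectorField.mlieBracketWithin_apply,
    mfderiv_extChartAt_self]
  refine (key _ rfl _).trans ?_
  change VectorField.lieBracketWithin ℝ (chartField I p X) (chartField I p Y)
    ((extChartAt I p).symm ⁻¹' Set.univ ∩ Set.range I) (extChartAt I p p) = _
  rw [I.range_eq_univ, Set.preimage_univ, Set.univ_inter, VectorField.lieBracketWithin_univ,
    VectorField.lieBracket, chartField_apply_self, chartField_apply_self]

lemma mvfderiv_eq_chartField {f : M → G} {p : M} (hf : CMDiffAt 1 f p)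
    (Y : Π x : M, TangentSpace I x) :
    ∀ᶠ q in 𝓝 p, mvfderiv I f q (Y q) =
      fderiv ℝ (f ∘ (extChartAt I p).symm) (extChartAt I p q)
        (chartField I p Y (extChartAt I p q)) := by
  have hev := (contMDiffAt_iff_contMDiffAt_nhds (n := 1) (by simp)).1 hf
  filter_upwards [hev, extChartAt_source_mem_nhds (I := I) p] with q hq hqs
  have hinv : (extChartAt I p).symm (extChartAt I p q) = q := (extChartAt I p).left_inv hqs
  have hmem : extChartAt I p q ∈ (extChartAt I p).target := (extChartAt I p).map_source hqs
  have hsymm : MDifferentiableAt 𝓘(ℝ, E) I (extChartAt I p).symm (extChartAt I p q) := by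
    have := mdifferentiableWithinAt_extChartAt_symm hmem
    rwa [I.range_eq_univ, mdifferentiableWithinAt_univ] at this
  have hinvt := isInvertible_mfderivWithin_extChartAt_symm hmem
  rw [← mfderiv_eq_fderiv]
  have hfd : MDifferentiableAt I 𝓘(ℝ, G) f ((extChartAt I p).symm (extChartAt I p q)) := by
    rw [hinv]; exact hq.mdifferentiableAt one_ne_zero
  have hc := mfderiv_comp (extChartAt I p q) hfd hsymm
  rw [hc, chartField, VectorField.mpullbackWithin]
  rw [I.range_eq_univ, mfderivWithin_univ] at hinvt ⊢
  have key (q' : M) (hq' : q' = q) (A : E →L[ℝ] TangentSpace I q') (hA : A.IsInvertible) :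
      mvfderiv I f q (Y q) = mfderiv I 𝓘(ℝ, G) f q' (A (A.inverse (Y q'))) := by
    subst hq'
    rw [hA.self_apply_inverse]
    rfl
  exact key _ hinv _ hinvt

lemma mvfderiv_comp_extChartAt {g : E → G} {p : M}
    (hg : DifferentiableAt ℝ g (extChartAt I p p)) (v : TangentSpace I p) :
    mvfderiv I (fun q ↦ g (extChartAt I p q)) p v = fderiv ℝ g (extChartAt I p p) v := by
  have h := mfderiv_comp p hg.mdifferentiableAt
    (mdifferentiableAt_extChartAt (I := I) (mem_chart_source H p))
  rw [mfderiv_extChartAt_self, mfderiv_eq_fderiv] at h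
  exact congrArg (fun L : E →L[ℝ] G ↦ L v) h

lemma differentiableAt_fderiv_chartField {f : M → G} {p : M} (hf : CMDiffAt ∞ f p)
    {Y : Π x : M, TangentSpace I x} (hY : MDiffAt (T% Y) p) :
    DifferentiableAt ℝ (fun x ↦ fderiv ℝ (f ∘ (extChartAt I p).symm) x (chartField I p Y x))
      (extChartAt I p p) := by
  have hd : ContDiffAt ℝ 1 (fderiv ℝ (f ∘ (extChartAt I p).symm)) (extChartAt I p p) :=
    (contDiffAt_comp_extChartAt_symm hf).fderiv_right (by norm_cast)
  exact (hd.differentiableAt one_ne_zero).clm_apply (differentiableAt_chartField hY)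

lemma mvfderiv_congr {f g : M → G} {p : M} (h : f =ᶠ[𝓝 p] g) (v : TangentSpace I p) :
    mvfderiv I f p v = mvfderiv I g p v :=
  congrArg (fun L : E →L[ℝ] G ↦ L v) (h.mfderiv_eq (I := I) (I' := 𝓘(ℝ, G)))

lemma mvfderiv_mvfderiv_field {f : M → G} {p : M} (hf : CMDiffAt ∞ f p)
    {Y : Π x : M, TangentSpace I x} (hY : MDiffAt (T% Y) p) (v : TangentSpace I p) :
    mvfderiv I (fun q ↦ mvfderiv I f q (Y q)) p v =
      fderiv ℝ (f ∘ (extChartAt I p).symm) (extChartAt I p p)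
          (fderiv ℝ (chartField I p Y) (extChartAt I p p) v)
        + fderiv ℝ (fderiv ℝ (f ∘ (extChartAt I p).symm)) (extChartAt I p p) v (Y p) := by
  rw [mvfderiv_congr (mvfderiv_eq_chartField (hf.of_le (by norm_cast)) Y),
    mvfderiv_comp_extChartAt (differentiableAt_fderiv_chartField hf hY)]
  have hd : ContDiffAt ℝ 1 (fderiv ℝ (f ∘ (extChartAt I p).symm)) (extChartAt I p p) :=
    (contDiffAt_comp_extChartAt_symm hf).fderiv_right (by norm_cast)
  rw [fderiv_clm_apply (hd.differentiableAt one_ne_zero) (differentiableAt_chartField hY)]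
  rw [← chartField_apply_self Y p]
  rfl

/-- The Lie bracket of vector fields is the commutator of the derivations that they define. -/
lemma mvfderiv_mlieBracket {f : M → G} {p : M} (hf : CMDiffAt ∞ f p)
    {X Y : Π x : M, TangentSpace I x} (hX : MDiffAt (T% X) p) (hY : MDiffAt (T% Y) p) :
    mvfderiv I f p (VectorField.mlieBracket I X Y p) =
      mvfderiv I (fun q ↦ mvfderiv I f q (Y q)) p (X p)
        - mvfderiv I (fun q ↦ mvfderiv I f q (X q)) p (Y p) := by
  have h1 := (mvfderiv_eq_chartField (I := I) (hf.of_le (by norm_cast) : CMDiffAt 1 f p)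
    (VectorField.mlieBracket I X Y)).self_of_nhds
  rw [h1, chartField_apply_self, mlieBracket_eq_chartField, mvfderiv_mvfderiv_field hf hX,
    mvfderiv_mvfderiv_field hf hY]
  have hs : IsSymmSndFDerivAt ℝ (f ∘ (extChartAt I p).symm) (extChartAt I p p) :=
    (contDiffAt_comp_extChartAt_symm hf).isSymmSndFDerivAt
      (by rw [minSmoothness_of_isRCLikeNormedField]; norm_cast)
  have := hs.eq (X p) (Y p)
  rw [this]
  erw [map_sub]
  abel

/-- The coordinates of a tangent vector in the trivialization around `p` are the components of the
derivative of the extended chart. -/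
lemma trivializationAt_snd {p q : M} (hq : q ∈ (chartAt H p).source) (w : TangentSpace I q) :
    (trivializationAt E (fun x : M ↦ TangentSpace I x) p ⟨q, w⟩).2
      = mvfderiv I (extChartAt I p) q w := by
  have h := TangentBundle.continuousLinearMapAt_trivializationAt (I := I) hq
  have hb : q ∈ (trivializationAt E (fun x : M ↦ TangentSpace I x) p).baseSet := by
    rwa [TangentBundle.trivializationAt_baseSet]
  have h2 := congrArg (fun L : TangentSpace I q →L[ℝ] E ↦ L w) h
  refine Eq.trans ?_ h2
  change _ = (trivializationAt E (fun x : M ↦ TangentSpace I x) p).linearMapAt ℝ q w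
  rw [Bundle.Trivialization.coe_linearMapAt_of_mem _ hb]

lemma mvfderiv_extChartAt_self (p : M) (v : TangentSpace I p) :
    mvfderiv I (extChartAt I p) p v = v :=
  congrArg (fun L : E →L[ℝ] E ↦ L v) (mfderiv_extChartAt_self (I := I) (x := p))

lemma mvfderiv_extChartAt_extend {p : M} (v : TangentSpace I p) :
    ∀ᶠ q in 𝓝 p, mvfderiv I (extChartAt I p) q (FiberBundle.extend E v q) = v := by
  filter_upwards [chart_source_mem_nhds H p] with q hq
  have hb : q ∈ (trivializationAt E (fun x : M ↦ TangentSpace I x) p).baseSet := by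
    rwa [TangentBundle.trivializationAt_baseSet]
  rw [← trivializationAt_snd hq, FiberBundle.extend, Bundle.Trivialization.apply_mk_symm _ hb,
    trivializationAt_snd (mem_chart_source H p), mvfderiv_extChartAt_self]

lemma mlieBracket_extend {p : M} (v w : TangentSpace I p) :
    VectorField.mlieBracket I (FiberBundle.extend E v) (FiberBundle.extend E w) p = 0 := by
  have h := mvfderiv_mlieBracket (f := extChartAt I p) (contMDiffAt_extChartAt (I := I) (n := ∞))
    (FiberBundle.mdifferentiableAt_extend I E v) (FiberBundle.mdifferentiableAt_extend I E w)
  have hc (u u' : E) : mvfderiv I (fun _ : M ↦ u) p u' = 0 := by rw [mvfderiv_const]; rfl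
  rw [mvfderiv_extChartAt_self, mvfderiv_congr (mvfderiv_extChartAt_extend v),
    mvfderiv_congr (mvfderiv_extChartAt_extend w)] at h
  refine h.trans ((congrArg₂ (fun a b : E ↦ a - b) (hc w _) (hc v _)).trans (sub_zero _))

end Bracket

section Pullback

variable {E : Type*} [NormedAddCommGroup E] [NormedSpace ℝ E] [FiniteDimensional ℝ E]
  {H : Type*} [TopologicalSpace H] {I : ModelWithCorners ℝ E H} [I.Boundaryless]
  {M : Type*} [TopologicalSpace M] [ChartedSpace H M] [IsManifold I ∞ M]
  {E' : Type*} [NormedAddCommGroup E'] [NormedSpace ℝ E'] [FiniteDimensional ℝ E']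
  {H' : Type*} [TopologicalSpace H'] {I' : ModelWithCorners ℝ E' H'} [I'.Boundaryless]
  {N : Type*} [TopologicalSpace N] [ChartedSpace H' N] [IsManifold I' ∞ N]
  [RiemannianBundle (fun x : N ↦ TangentSpace I' x)]
  [IsContMDiffRiemannianBundle I' ∞ E' (fun x : N ↦ TangentSpace I' x)]

lemma leviCivita_congr {X Y : Π y : N, TangentSpace I' y} {y : N} (hX : MDiffAt (T% X) y)
    (hY : MDiffAt (T% Y) y) (h : ∀ᶠ z in 𝓝 y, X z = Y z) :
    leviCivita I' N X y = leviCivita I' N Y y :=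
  (leviCivita I' N).isCovariantDerivativeOnUniv.congr_of_eventuallyEq hX hY Filter.univ_mem h

lemma extend_add {y : N} (v w : TangentSpace I' y) :
    ∀ᶠ z in 𝓝 y, FiberBundle.extend E' (v + w) z
      = (FiberBundle.extend E' v + FiberBundle.extend E' w) z := by
  have hy := FiberBundle.mem_baseSet_trivializationAt' (F := E')
    (E := fun x : N ↦ TangentSpace I' x) y
  simp only [FiberBundle.extend, Pi.add_apply]
  set e := trivializationAt E' (fun x : N ↦ TangentSpace I' x) y
  have hadd : (e ⟨y, v + w⟩).2 = (e ⟨y, v⟩).2 + (e ⟨y, w⟩).2 := (e.linear ℝ hy).map_add v w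
  filter_upwards [e.open_baseSet.mem_nhds hy] with z hz
  rw [hadd, ← e.symmL_apply (R := ℝ) hz, ← e.symmL_apply (R := ℝ) hz,
    ← e.symmL_apply (R := ℝ) hz, map_add]

lemma extend_smul {y : N} (c : ℝ) (v : TangentSpace I' y) :
    ∀ᶠ z in 𝓝 y, FiberBundle.extend E' (c • v) z = (c • FiberBundle.extend E' v) z := by
  have hy := FiberBundle.mem_baseSet_trivializationAt' (F := E')
    (E := fun x : N ↦ TangentSpace I' x) y
  simp only [FiberBundle.extend, Pi.smul_apply]
  set e := trivializationAt E' (fun x : N ↦ TangentSpace I' x) y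
  have hadd : (e ⟨y, c • v⟩).2 = c • (e ⟨y, v⟩).2 := (e.linear ℝ hy).map_smul c v
  filter_upwards [e.open_baseSet.mem_nhds hy] with z hz
  rw [hadd, ← e.symmL_apply (R := ℝ) hz, ← e.symmL_apply (R := ℝ) hz, map_smul]

/-- The map `v ↦ ∇_w (extend v)`. -/
def covExtend {y : N} (w : TangentSpace I' y) : TangentSpace I' y →ₗ[ℝ] TangentSpace I' y where
  toFun v := leviCivita I' N (FiberBundle.extend E' v) y w
  map_add' u v := by
    have hu := FiberBundle.mdifferentiableAt_extend I' E' u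
    have hv := FiberBundle.mdifferentiableAt_extend I' E' v
    rw [leviCivita_congr (FiberBundle.mdifferentiableAt_extend I' E' (u + v))
      (mdifferentiableAt_add_section hu hv) (extend_add u v),
      (leviCivita I' N).isCovariantDerivativeOnUniv.add hu hv]
    rfl
  map_smul' c v := by
    have hv := FiberBundle.mdifferentiableAt_extend I' E' v
    rw [leviCivita_congr (FiberBundle.mdifferentiableAt_extend I' E' (c • v))
      (mdifferentiableAt_const.smul_section hv) (extend_smul c v)]
    exact congrArg (fun L : TangentSpace I' y →L[ℝ] TangentSpace I' y ↦ L w)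
      ((leviCivita I' N).isCovariantDerivativeOnUniv.smul_const c hv)

lemma covExtend_apply {y : N} (w v : TangentSpace I' y) :
    covExtend w v = leviCivita I' N (FiberBundle.extend E' v) y w := rfl

/-- The coordinates of a section along `F` in the trivialization around `F p`. -/
def coordAlong (F : M → N) (p : M) (s : Π q : M, TangentSpace I' (F q)) (q : M) : E' :=
  (trivializationAt E' (fun y : N ↦ TangentSpace I' y) (F p) ⟨F q, s q⟩).2

lemma mdifferentiableAt_coordAlong {F : M → N} {p : M} {s : Π q : M, TangentSpace I' (F q)}
    (hs : MDifferentiableAt I I'.tangent (fun q ↦ (⟨F q, s q⟩ : TangentBundle I' N)) p) :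
    MDiffAt (coordAlong (I' := I') F p s) p :=
  ((mdifferentiableAt_totalSpace _ _).1 hs).2

lemma mdifferentiableAt_of_along {F : M → N} {p : M} {s : Π q : M, TangentSpace I' (F q)}
    (hs : MDifferentiableAt I I'.tangent (fun q ↦ (⟨F q, s q⟩ : TangentBundle I' N)) p) :
    MDifferentiableAt I I' F p :=
  ((mdifferentiableAt_totalSpace _ _).1 hs).1

/-- The elements of a basis of the model space, as tangent vectors at `y`. -/
def frameVec {ι : Type*} (b : Module.Basis ι ℝ E') (y : N) (i : ι) : TangentSpace I' y :=
  (trivializationAt E' (fun y : N ↦ TangentSpace I' y) y).symm y (b i)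

lemma symm_eq_sum {ι : Type*} [Fintype ι] (b : Module.Basis ι ℝ E') {y z : N} (c : E')
    (hz : z ∈ (trivializationAt E' (fun y : N ↦ TangentSpace I' y) y).baseSet) :
    (trivializationAt E' (fun y : N ↦ TangentSpace I' y) y).symm z c =
      ∑ i, b.repr c i • FiberBundle.extend E' (frameVec (I' := I') b y i) z := by
  have hy := FiberBundle.mem_baseSet_trivializationAt' (F := E')
    (E := fun x : N ↦ TangentSpace I' x) y
  simp only [FiberBundle.extend, frameVec]
  set e := trivializationAt E' (fun x : N ↦ TangentSpace I' x) y
  simp only [e.apply_mk_symm hy]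
  conv_lhs => rw [← b.sum_repr c]
  rw [← e.symmL_apply (R := ℝ) hz, map_sum]
  refine Finset.sum_congr rfl fun i _ ↦ ?_
  rw [map_smul, e.symmL_apply (R := ℝ) hz]

lemma along_eq_sum {ι : Type*} [Fintype ι] (b : Module.Basis ι ℝ E') (F : M → N) {p q : M}
    (s : Π q : M, TangentSpace I' (F q))
    (hq : F q ∈ (trivializationAt E' (fun y : N ↦ TangentSpace I' y) (F p)).baseSet) :
    s q = ∑ i, b.repr (coordAlong (I' := I') F p s q) i •
      FiberBundle.extend E' (frameVec (I' := I') b (F p) i) (F q) := by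
  rw [← symm_eq_sum b _ hq, coordAlong, Bundle.Trivialization.symm_apply_apply_mk _ hq]

variable {G : Type*} [NormedAddCommGroup G] [NormedSpace ℝ G]

lemma mdifferentiableAt_finset_sum {ι : Type*} {p : M} (s : Finset ι) {f : ι → M → ℝ}
    (hf : ∀ i ∈ s, MDiffAt (f i) p) : MDiffAt (fun q ↦ ∑ i ∈ s, f i q) p := by
  classical
  induction s using Finset.induction_on with
  | empty => simpa using mdifferentiableAt_const
  | insert a s ha ih =>
    simp only [Finset.sum_insert ha]
    exact (hf a (by simp)).add (ih fun i hi ↦ hf i (by simp [hi]))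

lemma mvfderiv_finset_sum {ι : Type*} {p : M} (s : Finset ι) {f : ι → M → ℝ}
    (hf : ∀ i ∈ s, MDiffAt (f i) p) (v : TangentSpace I p) :
    mvfderiv I (fun q ↦ ∑ i ∈ s, f i q) p v = ∑ i ∈ s, mvfderiv I (f i) p v := by
  classical
  induction s using Finset.induction_on with
  | empty => simp [mvfderiv_const]
  | insert a s ha ih =>
    simp only [Finset.sum_insert ha]
    have h := mvfderiv_add (hf a (by simp))
      (mdifferentiableAt_finset_sum s fun i hi ↦ hf i (by simp [hi]))
    have h2 := congrArg (fun L : TangentSpace I p →L[ℝ] ℝ ↦ L v) h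
    refine h2.trans ?_
    rw [add_apply, ih fun i hi ↦ hf i (by simp [hi])]

lemma mvfderiv_clm_comp (L : G →L[ℝ] ℝ) {f : M → G} {p : M} (hf : MDiffAt f p)
    (v : TangentSpace I p) : mvfderiv I (fun q ↦ L (f q)) p v = L (mvfderiv I f p v) := by
  have h := mfderiv_comp p (L.differentiableAt.mdifferentiableAt (x := f p)) hf
  rw [mfderiv_eq_fderiv, L.fderiv] at h
  exact congrArg (fun A : E →L[ℝ] ℝ ↦ A v) h

lemma pullbackCov_eq_sum {ι : Type*} [Fintype ι] (b : Module.Basis ι ℝ E') {F : M → N} {p : M}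
    {s : Π q : M, TangentSpace I' (F q)}
    (hs : MDifferentiableAt I I'.tangent (fun q ↦ (⟨F q, s q⟩ : TangentBundle I' N)) p)
    (v : TangentSpace I p) :
    pullbackCov I I' F s p v = ∑ i,
      (mvfderiv I (fun q ↦ b.repr (coordAlong (I' := I') F p s q) i) p v • frameVec b (F p) i
        + b.repr (coordAlong (I' := I') F p s p) i •
          leviCivita I' N (FiberBundle.extend E' (frameVec b (F p) i)) (F p)
            (mfderiv I I' F p v)) := by
  have hy := FiberBundle.mem_baseSet_trivializationAt' (F := E')
    (E := fun x : N ↦ TangentSpace I' x) (F p)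
  rw [pullbackCov, symm_eq_sum b _ hy, Finset.sum_add_distrib]
  congr 1
  · refine Finset.sum_congr rfl fun i _ ↦ ?_
    rw [FiberBundle.extend_apply_self]
    congr 1
    exact (mvfderiv_clm_comp (b.coord i).toContinuousLinearMap
      (mdifferentiableAt_coordAlong hs) v).symm
  · have h1 := along_eq_sum b F (p := p) s hy
    simp only [FiberBundle.extend_apply_self] at h1
    have h2 := congrArg (covExtend (mfderiv I I' F p v)) h1
    rw [map_sum] at h2
    simpa only [map_smul, covExtend_apply] using h2

/-- The pullback connection is compatible with the metric. -/
lemma mvfderiv_inner_along {F : M → N} {p : M} {s t : Π q : M, TangentSpace I' (F q)}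
    (hs : MDifferentiableAt I I'.tangent (fun q ↦ (⟨F q, s q⟩ : TangentBundle I' N)) p)
    (ht : MDifferentiableAt I I'.tangent (fun q ↦ (⟨F q, t q⟩ : TangentBundle I' N)) p)
    (v : TangentSpace I p) :
    mvfderiv I (fun q ↦ (inner ℝ (s q) (t q) : ℝ)) p v =
      inner ℝ (pullbackCov I I' F s p v) (t p) + inner ℝ (s p) (pullbackCov I I' F t p v) := by
  have hy := FiberBundle.mem_baseSet_trivializationAt' (F := E')
    (E := fun x : N ↦ TangentSpace I' x) (F p)
  have hF := mdifferentiableAt_of_along hs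
  let b := Module.finBasis ℝ E'
  let X (i : Fin (Module.finrank ℝ E')) : Π y : N, TangentSpace I' y :=
    FiberBundle.extend E' (frameVec (I' := I') b (F p) i)
  have hX (i) : MDiffAt (T% (X i)) (F p) := FiberBundle.mdifferentiableAt_extend I' E' _
  let a (i : Fin (Module.finrank ℝ E')) (q : M) : ℝ := b.repr (coordAlong (I' := I') F p s q) i
  let c (i : Fin (Module.finrank ℝ E')) (q : M) : ℝ := b.repr (coordAlong (I' := I') F p t q) i
  have ha (i) : MDiffAt (a i) p :=
    (b.coord i).toContinuousLinearMap.differentiableAt.mdifferentiableAt.comp p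
      (mdifferentiableAt_coordAlong hs)
  have hc (i) : MDiffAt (c i) p :=
    (b.coord i).toContinuousLinearMap.differentiableAt.mdifferentiableAt.comp p
      (mdifferentiableAt_coordAlong ht)
  have hG (i j) : MDiffAt (metricFun I' (X i) (X j)) (F p) := mdiffAt_metricFun (hX i) (hX j)
  have hGF (i j) : MDiffAt (metricFun I' (X i) (X j) ∘ F) p := (hG i j).comp p hF
  have hev : (fun q ↦ (inner ℝ (s q) (t q) : ℝ)) =ᶠ[𝓝 p] fun q ↦
      ∑ i, ∑ j, (a i * c j * (metricFun I' (X i) (X j) ∘ F)) q := by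
    have hb := hF.continuousAt.eventually
      ((trivializationAt E' (fun y : N ↦ TangentSpace I' y) (F p)).open_baseSet.mem_nhds hy)
    filter_upwards [hb] with q hq
    rw [along_eq_sum b F (p := p) s hq, along_eq_sum b F (p := p) t hq, sum_inner]
    refine Finset.sum_congr rfl fun i _ ↦ ?_
    rw [inner_sum]
    refine Finset.sum_congr rfl fun j _ ↦ ?_
    rw [real_inner_smul_left, real_inner_smul_right, ← mul_assoc]
    rfl
  rw [mvfderiv_congr hev, mvfderiv_finset_sum _ (fun i _ ↦ mdifferentiableAt_finset_sum _
    fun j _ ↦ ((ha i).mul (hc j)).mul (hGF i j)), pullbackCov_eq_sum b hs, pullbackCov_eq_sum b ht]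
  have hsp := along_eq_sum b F (p := p) s hy
  have htp := along_eq_sum b F (p := p) t hy
  rw [htp, hsp, sum_inner, sum_inner, ← Finset.sum_add_distrib]
  refine Finset.sum_congr rfl fun i _ ↦ ?_
  rw [mvfderiv_finset_sum _ (fun j _ ↦ ((ha i).mul (hc j)).mul (hGF i j)), inner_sum, inner_sum,
    ← Finset.sum_add_distrib]
  refine Finset.sum_congr rfl fun j _ ↦ ?_
  have hprod : mvfderiv I (a i * c j * (metricFun I' (X i) (X j) ∘ F)) p v =
      a i p * c j p * mvfderiv I' (metricFun I' (X i) (X j)) (F p) (mfderiv I I' F p v)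
        + metricFun I' (X i) (X j) (F p) *
          (a i p * mvfderiv I (c j) p v + c j p * mvfderiv I (a i) p v) := by
    rw [mvfderiv_mul ((ha i).mul (hc j)) (hGF i j), mvfderiv_mul (ha i) (hc j)]
    simp only [add_apply, smul_apply, smul_eq_mul, Function.comp_apply, Pi.mul_apply]
    rw [mvfderiv_comp_apply p (hG i j) hF]
  have hmet := metric_leviCivita
    (FiberBundle.mdifferentiableAt_extend I' E' (mfderiv I I' F p v)) (hX i) (hX j)
  rw [FiberBundle.extend_apply_self] at hmet
  refine hprod.trans ?_
  rw [hmet]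
  simp only [metricFun, X, FiberBundle.extend_apply_self, inner_add_left, inner_add_right,
    real_inner_smul_left, real_inner_smul_right, a, c]
  ring

lemma contMDiffAt_mfderiv_field {F : M → N} (hF : ContMDiff I I' ∞ F) {p : M}
    {Y : Π x : M, TangentSpace I x} (hY : CMDiffAt ∞ (T% Y) p) :
    ContMDiffAt I I'.tangent ∞ (fun q ↦ (⟨F q, mfderiv I I' F q (Y q)⟩ : TangentBundle I' N)) p :=
  (hF.contMDiff_tangentMap (m := ∞) (by norm_cast)).contMDiffAt.comp p hY

lemma mdifferentiableAt_mfderiv_field {F : M → N} (hF : ContMDiff I I' ∞ F) {p : M}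
    {Y : Π x : M, TangentSpace I x} (hY : MDiffAt (T% Y) p) :
    MDifferentiableAt I I'.tangent
      (fun q ↦ (⟨F q, mfderiv I I' F q (Y q)⟩ : TangentBundle I' N)) p :=
  ((hF.contMDiff_tangentMap (m := ∞) (by norm_cast)).contMDiffAt.mdifferentiableAt
    (by simp)).comp p hY

lemma coordAlong_mfderiv {F : M → N} (hF : ContMDiff I I' ∞ F) (p : M)
    (Y : Π x : M, TangentSpace I x) :
    coordAlong (I' := I') F p (fun q ↦ mfderiv I I' F q (Y q)) =ᶠ[𝓝 p]
      fun q ↦ mvfderiv I (extChartAt I' (F p) ∘ F) q (Y q) := by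
  filter_upwards [hF.continuous.continuousAt.eventually (chart_source_mem_nhds H' (F p))]
    with q hq
  rw [coordAlong, trivializationAt_snd hq]
  exact (mfderiv_comp_apply q (mdifferentiableAt_extChartAt hq)
    (hF.mdifferentiableAt (by simp)) (Y q)).symm

lemma leviCivita_sub_extend {y : N} (v w : TangentSpace I' y) :
    leviCivita I' N (FiberBundle.extend E' w) y v - leviCivita I' N (FiberBundle.extend E' v) y w
      = 0 := by
  have h := ((leviCivita I' N).torsion_eq_zero_iff.1 torsion_leviCivita)
    (FiberBundle.mdifferentiableAt_extend I' E' v) (FiberBundle.mdifferentiableAt_extend I' E' w)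
  rw [mlieBracket_extend, FiberBundle.extend_apply_self, FiberBundle.extend_apply_self] at h
  exact h

/-- The pullback connection is torsion-free. -/
lemma pullbackCov_sub {F : M → N} (hF : ContMDiff I I' ∞ F) {p : M}
    {X Y : Π x : M, TangentSpace I x} (hX : MDiffAt (T% X) p) (hY : MDiffAt (T% Y) p) :
    pullbackCov I I' F (fun q ↦ mfderiv I I' F q (Y q)) p (X p)
      - pullbackCov I I' F (fun q ↦ mfderiv I I' F q (X q)) p (Y p)
      = mfderiv I I' F p (VectorField.mlieBracket I X Y p) := by
  have hy := FiberBundle.mem_baseSet_trivializationAt' (F := E')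
    (E := fun x : N ↦ TangentSpace I' x) (F p)
  have hf : CMDiffAt ∞ (extChartAt I' (F p) ∘ F) p :=
    contMDiffAt_extChartAt.comp p hF.contMDiffAt
  have hX' := mvfderiv_congr (coordAlong_mfderiv hF p X) (Y p)
  have hY' := mvfderiv_congr (coordAlong_mfderiv hF p Y) (X p)
  have hbr := (coordAlong_mfderiv hF p (VectorField.mlieBracket I X Y)).self_of_nhds
  beta_reduce at hbr
  rw [mvfderiv_mlieBracket hf hX hY, ← hX', ← hY'] at hbr
  have hcov := leviCivita_sub_extend (mfderiv I I' F p (X p)) (mfderiv I I' F p (Y p))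
  rw [pullbackCov, pullbackCov, add_sub_add_comm, hcov, add_zero]
  rw [← Bundle.Trivialization.symm_apply_apply_mk _ hy (mfderiv I I' F p
    (VectorField.mlieBracket I X Y p))]
  change _ = (trivializationAt E' (fun y : N ↦ TangentSpace I' y) (F p)).symm (F p)
    (coordAlong (I' := I') F p (fun q ↦ mfderiv I I' F q (VectorField.mlieBracket I X Y q)) p)
  rw [hbr]
  set e := trivializationAt E' (fun x : N ↦ TangentSpace I' x) (F p)
  simp only [← e.symmL_apply (R := ℝ) hy, map_sub]
  rfl

variable [RiemannianBundle (fun x : M ↦ TangentSpace I x)]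
  [IsContMDiffRiemannianBundle I ∞ E (fun x : M ↦ TangentSpace I x)]

lemma secondFundamentalForm_comm {F : M → N} (hF : ContMDiff I I' ∞ F) {p : M}
    {X Y : Π x : M, TangentSpace I x} (hX : MDiffAt (T% X) p) (hY : MDiffAt (T% Y) p) :
    secondFundamentalForm I I' F X Y p = secondFundamentalForm I I' F Y X p := by
  have h := pullbackCov_sub hF hX hY
  have h2 := ((leviCivita I M).torsion_eq_zero_iff.1 torsion_leviCivita)
    hX hY
  rw [← h2, map_sub] at h
  rw [secondFundamentalForm, secondFundamentalForm, sub_eq_sub_iff_sub_eq_sub]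
  exact h

/-- The second fundamental form at `p` is additive in the value of its first argument. -/
lemma secondFundamentalForm_add_left {F : M → N} {p : M} {X X' X'' Y : Π x : M, TangentSpace I x}
    (h : X p = X' p + X'' p) : secondFundamentalForm I I' F X Y p =
      secondFundamentalForm I I' F X' Y p + secondFundamentalForm I I' F X'' Y p := by
  have hy := FiberBundle.mem_baseSet_trivializationAt' (F := E')
    (E := fun x : N ↦ TangentSpace I' x) (F p)
  simp only [secondFundamentalForm, pullbackCov, h, map_add]
  set e := trivializationAt E' (fun x : N ↦ TangentSpace I' x) (F p)
  simp only [← e.symmL_apply (R := ℝ) hy, map_add]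
  abel

lemma secondFundamentalForm_smul_left {F : M → N} {p : M} {X X' Y : Π x : M, TangentSpace I x}
    {c : ℝ} (h : X p = c • X' p) :
    secondFundamentalForm I I' F X Y p = c • secondFundamentalForm I I' F X' Y p := by
  have hy := FiberBundle.mem_baseSet_trivializationAt' (F := E')
    (E := fun x : N ↦ TangentSpace I' x) (F p)
  simp only [secondFundamentalForm, pullbackCov, h, map_smul]
  set e := trivializationAt E' (fun x : N ↦ TangentSpace I' x) (F p)
  simp only [← e.symmL_apply (R := ℝ) hy, map_smul]
  module

lemma secondFundamentalForm_congr {F : M → N} (hF : ContMDiff I I' ∞ F) {p : M}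
    {X X' Y Y' : Π x : M, TangentSpace I x} (hX' : MDiffAt (T% X') p)
    (hY : MDiffAt (T% Y) p) (hY' : MDiffAt (T% Y') p) (h : X p = X' p) (h' : Y p = Y' p) :
    secondFundamentalForm I I' F X Y p = secondFundamentalForm I I' F X' Y' p := by
  rw [secondFundamentalForm_smul_left (X := X) (X' := X') (c := 1) (by simpa using h), one_smul,
    secondFundamentalForm_comm hF hX' hY,
    secondFundamentalForm_smul_left (X := Y) (X' := Y') (c := 1) (by simpa using h'), one_smul,
    secondFundamentalForm_comm hF hY' hX']

/-- The second fundamental form at `p`, as a bilinear map. -/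
def secondFormAt {F : M → N} (hF : ContMDiff I I' ∞ F) (p : M) :
    TangentSpace I p →ₗ[ℝ] TangentSpace I p →ₗ[ℝ] TangentSpace I' (F p) :=
  LinearMap.mk₂ ℝ
    (fun v w ↦ secondFundamentalForm I I' F (FiberBundle.extend E v) (FiberBundle.extend E w) p)
    (fun v v' w ↦ secondFundamentalForm_add_left (by simp))
    (fun c v w ↦ secondFundamentalForm_smul_left (by simp))
    (fun v w w' ↦ by
      have h (u : TangentSpace I p) := FiberBundle.mdifferentiableAt_extend I E u
      simp only [secondFundamentalForm_comm hF (h v) (h _)]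
      exact secondFundamentalForm_add_left (by simp))
    (fun c v w ↦ by
      have h (u : TangentSpace I p) := FiberBundle.mdifferentiableAt_extend I E u
      simp only [secondFundamentalForm_comm hF (h v) (h _)]
      exact secondFundamentalForm_smul_left (by simp))

lemma secondFormAt_apply {F : M → N} (hF : ContMDiff I I' ∞ F) {p : M}
    {X Y : Π x : M, TangentSpace I x} (hX : MDiffAt (T% X) p) (hY : MDiffAt (T% Y) p) :
    secondFormAt hF p (X p) (Y p) = secondFundamentalForm I I' F X Y p :=
  secondFundamentalForm_congr hF hX (FiberBundle.mdifferentiableAt_extend I E _) hY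
    (by simp) (by simp)

lemma secondFormAt_comm {F : M → N} (hF : ContMDiff I I' ∞ F) {p : M}
    (v w : TangentSpace I p) : secondFormAt hF p v w = secondFormAt hF p w v :=
  secondFundamentalForm_comm hF (FiberBundle.mdifferentiableAt_extend I E _)
    (FiberBundle.mdifferentiableAt_extend I E _)

lemma sum_orthonormalBasis_eq {V W ι κ : Type*} [NormedAddCommGroup V] [InnerProductSpace ℝ V]
    [FiniteDimensional ℝ V] [AddCommGroup W] [Module ℝ W] [Fintype ι] [Fintype κ]
    (B : V →ₗ[ℝ] V →ₗ[ℝ] W) (e : OrthonormalBasis ι ℝ V) (f : OrthonormalBasis κ ℝ V) :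
    ∑ i, B (e i) (e i) = ∑ i, B (f i) (f i) := by
  have h := (InnerProductSpace.canonicalCovariantTensor_eq_sum V e).symm.trans
    (InnerProductSpace.canonicalCovariantTensor_eq_sum V f)
  simpa using congrArg (TensorProduct.lift B) h

lemma tensionField_eq_sum {F : M → N} (hF : ContMDiff I I' ∞ F) {p : M} {ι : Type*} [Fintype ι]
    (e : OrthonormalBasis ι ℝ (TangentSpace I p)) :
    tensionField I I' F p = ∑ i, secondFormAt hF p (e i) (e i) :=
  sum_orthonormalBasis_eq (secondFormAt hF p) (stdOrthonormalBasis ℝ (TangentSpace I p)) e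

end Pullback

section Sharp

variable {E : Type*} [NormedAddCommGroup E] [NormedSpace ℝ E] [FiniteDimensional ℝ E]
  {H : Type*} [TopologicalSpace H] {I : ModelWithCorners ℝ E H} [I.Boundaryless]
  {M : Type*} [TopologicalSpace M] [ChartedSpace H M] [IsManifold I ∞ M]
  [RiemannianBundle (fun x : M ↦ TangentSpace I x)]
  [IsContMDiffRiemannianBundle I ∞ E (fun x : M ↦ TangentSpace I x)]

lemma contMDiffAt_finset_sum {G ι : Type*} [NormedAddCommGroup G] [NormedSpace ℝ G] {p : M}
    {n : ℕ∞ω} (s : Finset ι) {f : ι → M → G}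
    (hf : ∀ i ∈ s, CMDiffAt n (f i) p) : CMDiffAt n (fun q ↦ ∑ i ∈ s, f i q) p := by
  classical
  induction s using Finset.induction_on with
  | empty => simpa using contMDiffAt_const
  | insert a s ha ih =>
    simp only [Finset.sum_insert ha]
    exact (hf a (by simp)).add (ih fun i hi ↦ hf i (by simp [hi]))

lemma contMDiffAt_inner {X Y : Π x : M, TangentSpace I x} {p : M}
    (hX : CMDiffAt ∞ (T% X) p) (hY : CMDiffAt ∞ (T% Y) p) :
    CMDiffAt ∞ (fun q ↦ (inner ℝ (X q) (Y q) : ℝ)) p :=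
  ContMDiffAt.inner_bundle (E := fun x : M ↦ TangentSpace I x) (b := fun x ↦ x) hX hY

/-- A vector field is smooth at `p` if its inner products with the fields `extend w` are. -/
lemma contMDiffAt_of_inner {X : Π x : M, TangentSpace I x} {p : M}
    (h : ∀ w : TangentSpace I p,
      CMDiffAt ∞ (fun q ↦ (inner ℝ (X q) (FiberBundle.extend E w q) : ℝ)) p) :
    CMDiffAt ∞ (T% X) p := by
  classical
  have hy := FiberBundle.mem_baseSet_trivializationAt' (F := E)
    (E := fun x : M ↦ TangentSpace I x) p
  let b := Module.finBasis ℝ E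
  let e (i : Fin (Module.finrank ℝ E)) : Π x : M, TangentSpace I x :=
    FiberBundle.extend E (frameVec (I' := I) b p i)
  have he (i) : CMDiffAt ∞ (T% (e i)) p := FiberBundle.contMDiffAt_extend I E _
  let T (i j : Fin (Module.finrank ℝ E)) : E →L[ℝ] (Fin (Module.finrank ℝ E) → ℝ) :=
    (b.coord i).toContinuousLinearMap.smulRight (Pi.single j 1)
  let A (q : M) : E →L[ℝ] (Fin (Module.finrank ℝ E) → ℝ) :=
    ∑ i, ∑ j, (inner ℝ (e i q) (e j q) : ℝ) • T i j
  have hA : CMDiffAt ∞ A p := contMDiffAt_finset_sum _ fun i _ ↦ contMDiffAt_finset_sum _ fun j _ ↦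
    (contMDiffAt_inner (he i) (he j)).smul contMDiffAt_const
  set t := trivializationAt E (fun x : M ↦ TangentSpace I x) p
  have hAq (q : M) (hq : q ∈ t.baseSet) (c : E) (j) : A q c j = inner ℝ (t.symm q c) (e j q) := by
    rw [symm_eq_sum b c hq, sum_inner]
    simp only [A, T, sum_apply, smul_apply, Finset.sum_apply, Pi.smul_apply,
      ContinuousLinearMap.smulRight_apply, LinearMap.coe_toContinuousLinearMap',
      Module.Basis.coord_apply, smul_eq_mul, real_inner_smul_left]
    refine Finset.sum_congr rfl fun i _ ↦ ?_
    rw [Finset.sum_eq_single j (fun k _ hk ↦ by simp [Pi.single_eq_of_ne hk.symm]) (by simp)]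
    simp [e, mul_comm]
  have hinj (q : M) (hq : q ∈ t.baseSet) : (A q).IsInvertible := by
    have hin : Function.Injective (A q : E →ₗ[ℝ] (Fin (Module.finrank ℝ E) → ℝ)) := by
      rw [injective_iff_map_eq_zero]
      intro c hc
      have h0 : (inner ℝ (t.symm q c) (t.symm q c) : ℝ) = 0 := by
        conv_lhs => rw [symm_eq_sum b c hq, inner_sum]
        refine Finset.sum_eq_zero fun j _ ↦ ?_
        rw [real_inner_smul_right, ← symm_eq_sum b c hq]
        have := congrFun hc j
        rw [ContinuousLinearMap.coe_coe, hAq q hq] at this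
        simp [e] at this
        rw [this, mul_zero]
      have h1 := inner_self_eq_zero.1 h0
      have h2 := t.apply_mk_symm hq c
      rw [h1] at h2
      have h3 : (t ⟨q, 0⟩).2 = 0 := (t.linear ℝ hq).map_zero
      rw [h2] at h3
      exact h3
    refine ⟨(LinearEquiv.ofInjectiveOfFinrankEq _ hin (by simp)).toContinuousLinearEquiv, ?_⟩
    ext
    simp
    rfl
  have hAinv : CMDiffAt ∞ (fun q ↦ (A q).inverse) p :=
    ((hinj p hy).contDiffAt_map_inverse (n := ∞)).contMDiffAt.comp p hA
  have hG : ContMDiffAt I 𝓘(ℝ, Fin (Module.finrank ℝ E) → ℝ) ∞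
      (fun q ↦ (fun j ↦ (inner ℝ (X q) (e j q) : ℝ))) p :=
    contMDiffAt_pi_space.2 fun j ↦ h _
  rw [contMDiffAt_section]
  refine (hAinv.clm_apply hG).congr_of_eventuallyEq ?_
  filter_upwards [t.open_baseSet.mem_nhds hy] with q hq
  have h4 : (fun j ↦ (inner ℝ (X q) (e j q) : ℝ)) = A q (t ⟨q, X q⟩).2 := by
    funext j
    rw [hAq q hq, t.symm_apply_apply_mk hq]
  rw [h4, (hinj q hq).inverse_apply_self]

end Sharp

section Conformal

variable {E : Type*} [NormedAddCommGroup E] [NormedSpace ℝ E] [FiniteDimensional ℝ E]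
  {H : Type*} [TopologicalSpace H] {I : ModelWithCorners ℝ E H} [I.Boundaryless]
  {M : Type*} [TopologicalSpace M] [ChartedSpace H M] [IsManifold I ∞ M]
  [RiemannianBundle (fun x : M ↦ TangentSpace I x)]
  [IsContMDiffRiemannianBundle I ∞ E (fun x : M ↦ TangentSpace I x)]
  {E' : Type*} [NormedAddCommGroup E'] [NormedSpace ℝ E'] [FiniteDimensional ℝ E']
  {H' : Type*} [TopologicalSpace H'] {I' : ModelWithCorners ℝ E' H'} [I'.Boundaryless]
  {N : Type*} [TopologicalSpace N] [ChartedSpace H' N] [IsManifold I' ∞ N]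
  [RiemannianBundle (fun x : N ↦ TangentSpace I' x)]
  [IsContMDiffRiemannianBundle I' ∞ E' (fun x : N ↦ TangentSpace I' x)]
  {F : M → N} {lam : M → ℝ}

lemma verProj_add_horProj (F : M → N) (p : M) (v : TangentSpace I p) :
    verProj I I' F p v + horProj I I' F p v = v :=
  (vertical I I' F p).starProjection_add_starProjection_orthogonal v

lemma verProj_mem (F : M → N) (p : M) (v : TangentSpace I p) :
    verProj I I' F p v ∈ vertical I I' F p :=
  (vertical I I' F p).starProjection_apply_mem v

lemma horProj_mem (F : M → N) (p : M) (v : TangentSpace I p) :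
    horProj I I' F p v ∈ (vertical I I' F p)ᗮ :=
  (vertical I I' F p)ᗮ.starProjection_apply_mem v

lemma mem_vertical {p : M} {v : TangentSpace I p} :
    v ∈ vertical I I' F p ↔ mfderiv I I' F p v = 0 := LinearMap.mem_ker

lemma mfderiv_horProj (p : M) (v : TangentSpace I p) :
    mfderiv I I' F p (horProj I I' F p v) = mfderiv I I' F p v := by
  conv_rhs => rw [← verProj_add_horProj (I' := I') F p v, map_add,
    mem_vertical.1 (verProj_mem F p v), zero_add]

lemma horProj_eq_self {p : M} {v : TangentSpace I p} (hv : v ∈ (vertical I I' F p)ᗮ) :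
    horProj I I' F p v = v := Submodule.starProjection_eq_self_iff.2 hv

lemma verProj_eq_self {p : M} {v : TangentSpace I p} (hv : v ∈ vertical I I' F p) :
    verProj I I' F p v = v := Submodule.starProjection_eq_self_iff.2 hv

lemma horProj_eq_zero {p : M} {v : TangentSpace I p} (hv : v ∈ vertical I I' F p) :
    horProj I I' F p v = 0 := by
  have := verProj_add_horProj (I' := I') F p v
  rwa [verProj_eq_self hv, add_eq_left] at this

lemma inner_vertical_horizontal {p : M} {v w : TangentSpace I p} (hv : v ∈ vertical I I' F p)
    (hw : w ∈ (vertical I I' F p)ᗮ) : (inner ℝ v w : ℝ) = 0 := hw v hv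

lemma inner_horProj_left {p : M} {v w : TangentSpace I p} (hw : w ∈ (vertical I I' F p)ᗮ) :
    (inner ℝ (horProj I I' F p v) w : ℝ) = inner ℝ v w := by
  conv_rhs => rw [← verProj_add_horProj (I' := I') F p v, inner_add_left,
    inner_vertical_horizontal (verProj_mem F p v) hw, zero_add]

lemma inner_verProj_left {p : M} {v w : TangentSpace I p} (hw : w ∈ vertical I I' F p) :
    (inner ℝ (verProj I I' F p v) w : ℝ) = inner ℝ v w := by
  conv_rhs => rw [← verProj_add_horProj (I' := I') F p v, inner_add_left,
    real_inner_comm w (horProj I I' F p v), inner_vertical_horizontal hw (horProj_mem F p v),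
    add_zero]

lemma IsHorizontallyConformalSubmersion.inner_mfderiv
    (hF : IsHorizontallyConformalSubmersion I I' F lam) {p : M} (v w : TangentSpace I p) :
    (inner ℝ (mfderiv I I' F p v) (mfderiv I I' F p w) : ℝ)
      = lam p ^ 2 * inner ℝ (horProj I I' F p v) w := by
  rw [← mfderiv_horProj p v, ← mfderiv_horProj p w,
    hF.conformal p _ (horProj_mem F p v) _ (horProj_mem F p w), real_inner_comm,
    inner_horProj_left (horProj_mem F p v), real_inner_comm]

lemma contMDiffAt_inner_mfderiv (hF : ContMDiff I I' ∞ F) {p : M}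
    {X Y : Π x : M, TangentSpace I x} (hX : CMDiffAt ∞ (T% X) p) (hY : CMDiffAt ∞ (T% Y) p) :
    CMDiffAt ∞ (fun q ↦ (inner ℝ (mfderiv I I' F q (X q)) (mfderiv I I' F q (Y q)) : ℝ)) p :=
  ContMDiffAt.inner_bundle (E := fun x : N ↦ TangentSpace I' x) (b := F)
    (contMDiffAt_mfderiv_field hF hX) (contMDiffAt_mfderiv_field hF hY)

lemma IsHorizontallyConformalSubmersion.contMDiffAt_smul_horProj
    (hF : IsHorizontallyConformalSubmersion I I' F lam) {p : M}
    {X : Π x : M, TangentSpace I x} (hX : CMDiffAt ∞ (T% X) p) :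
    CMDiffAt ∞ (T% (fun q ↦ lam q ^ 2 • horProj I I' F q (X q))) p := by
  refine contMDiffAt_of_inner fun w ↦ ?_
  refine (contMDiffAt_inner_mfderiv hF.smooth hX
    (FiberBundle.contMDiffAt_extend I E w)).congr_of_eventuallyEq (.of_forall fun q ↦ ?_)
  beta_reduce
  rw [hF.inner_mfderiv, real_inner_smul_left]

/-- The squared dilation is smooth. -/
lemma IsHorizontallyConformalSubmersion.contMDiffAt_sq
    (hF : IsHorizontallyConformalSubmersion I I' F lam) (hN : 0 < Module.finrank ℝ E') (p : M) :
    CMDiffAt ∞ (fun q ↦ lam q ^ 2) p := by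
  have : Nontrivial E' := Module.nontrivial_of_finrank_pos hN
  obtain ⟨y, hy⟩ := exists_ne (0 : E')
  obtain ⟨v, hv⟩ := hF.surjective p y
  let X : Π x : M, TangentSpace I x := FiberBundle.extend E v
  have hX : CMDiffAt ∞ (T% X) p := FiberBundle.contMDiffAt_extend I E v
  have h1 := contMDiffAt_inner_mfderiv hF.smooth hX hX
  have h2 := contMDiffAt_inner_mfderiv hF.smooth (hF.contMDiffAt_smul_horProj hX) hX
  have h0 : (inner ℝ (mfderiv I I' F p (X p)) (mfderiv I I' F p (X p)) : ℝ) ≠ 0 := by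
    rw [inner_self_ne_zero]
    simp only [X, FiberBundle.extend_apply_self]
    rw [hv]
    exact hy
  refine (h2.div₀ h1 h0).congr_of_eventuallyEq ?_
  filter_upwards [h1.continuousAt.eventually_ne h0] with q hq
  rw [Pi.div_apply, eq_div_iff hq, map_smul, mfderiv_horProj, real_inner_smul_left]

lemma IsHorizontallyConformalSubmersion.contMDiffAt_horProj
    (hF : IsHorizontallyConformalSubmersion I I' F lam) (hN : 0 < Module.finrank ℝ E') {p : M}
    {X : Π x : M, TangentSpace I x} (hX : CMDiffAt ∞ (T% X) p) :
    CMDiffAt ∞ (T% (fun q ↦ horProj I I' F q (X q))) p := by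
  have h := (((hF.contMDiffAt_sq hN p).inv₀ (pow_ne_zero 2 (hF.dilation_pos p).ne')).smul_section
    (hF.contMDiffAt_smul_horProj hX))
  refine h.congr_of_eventuallyEq (.of_forall fun q ↦ ?_)
  simp [smul_smul, (hF.dilation_pos q).ne']

lemma IsHorizontallyConformalSubmersion.contMDiffAt_verProj
    (hF : IsHorizontallyConformalSubmersion I I' F lam) (hN : 0 < Module.finrank ℝ E') {p : M}
    {X : Π x : M, TangentSpace I x} (hX : CMDiffAt ∞ (T% X) p) :
    CMDiffAt ∞ (T% (fun q ↦ verProj I I' F q (X q))) p := by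
  have h := hX.sub_section (hF.contMDiffAt_horProj hN hX)
  refine h.congr_of_eventuallyEq (.of_forall fun q ↦ ?_)
  simp [eq_sub_iff_add_eq, verProj_add_horProj]

lemma IsHorizontallyConformalSubmersion.mdifferentiableAt_dilation
    (hF : IsHorizontallyConformalSubmersion I I' F lam) (hN : 0 < Module.finrank ℝ E') (p : M) :
    MDiffAt lam p := by
  have h1 : DifferentiableAt ℝ Real.sqrt (lam p ^ 2) :=
    (Real.contDiffAt_sqrt (n := 1) (pow_ne_zero 2 (hF.dilation_pos p).ne')).differentiableAt
      one_ne_zero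
  have h2 := h1.mdifferentiableAt.comp p
    ((hF.contMDiffAt_sq hN p).mdifferentiableAt (by simp))
  refine h2.congr_of_eventuallyEq (.of_forall fun q ↦ ?_)
  simp [Real.sqrt_sq (hF.dilation_pos q).le]

lemma IsHorizontallyConformalSubmersion.mvfderiv_sq
    (hF : IsHorizontallyConformalSubmersion I I' F lam) (hN : 0 < Module.finrank ℝ E') (p : M)
    (v : TangentSpace I p) :
    mvfderiv I (fun q ↦ lam q ^ 2) p v = 2 * lam p * mvfderiv I lam p v := by
  have h := hF.mdifferentiableAt_dilation hN p
  have h1 : (fun q ↦ lam q ^ 2) = lam * lam := by funext q; simp [sq]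
  rw [h1, mvfderiv_mul h h]
  simp only [add_apply, smul_apply, smul_eq_mul]
  ring

/-- The horizontal homothety condition, in terms of the derivative of the squared dilation. -/
lemma IsHorizontallyConformalSubmersion.isHorizontallyHomothetic_iff
    (hF : IsHorizontallyConformalSubmersion I I' F lam) (hN : 0 < Module.finrank ℝ E') :
    IsHorizontallyHomothetic I I' F lam ↔ ∀ p, ∀ z ∈ (vertical I I' F p)ᗮ,
      mvfderiv I (fun q ↦ lam q ^ 2) p z = 0 := by
  have key (p : M) (z : TangentSpace I p) (hz : z ∈ (vertical I I' F p)ᗮ) :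
      mvfderiv I (fun q ↦ lam q ^ 2) p z
        = 2 * lam p * inner ℝ (horProj I I' F p (grad I lam p)) z := by
    rw [hF.mvfderiv_sq hN, inner_horProj_left hz, grad, InnerProductSpace.toDual_symm_apply]
  refine forall_congr' fun p ↦ ⟨fun h z hz ↦ by rw [key p z hz, h]; simp, fun h ↦ ?_⟩
  have h1 := h _ (horProj_mem F p (grad I lam p))
  rw [key p _ (horProj_mem F p _)] at h1
  have := (hF.dilation_pos p).ne'
  simpa [this] using h1

end Conformal

section Tension

variable {E : Type*} [NormedAddCommGroup E] [NormedSpace ℝ E] [FiniteDimensional ℝ E]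
  {H : Type*} [TopologicalSpace H] {I : ModelWithCorners ℝ E H} [I.Boundaryless]
  {M : Type*} [TopologicalSpace M] [ChartedSpace H M] [IsManifold I ∞ M]
  [RiemannianBundle (fun x : M ↦ TangentSpace I x)]
  [IsContMDiffRiemannianBundle I ∞ E (fun x : M ↦ TangentSpace I x)]
  {E' : Type*} [NormedAddCommGroup E'] [NormedSpace ℝ E'] [FiniteDimensional ℝ E']
  {H' : Type*} [TopologicalSpace H'] {I' : ModelWithCorners ℝ E' H'} [I'.Boundaryless]
  {N : Type*} [TopologicalSpace N] [ChartedSpace H' N] [IsManifold I' ∞ N]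
  [RiemannianBundle (fun x : N ↦ TangentSpace I' x)]
  [IsContMDiffRiemannianBundle I' ∞ E' (fun x : N ↦ TangentSpace I' x)]
  {F : M → N} {lam : M → ℝ}

/-- The second fundamental form of a horizontally conformal submersion on horizontal vectors. -/
lemma IsHorizontallyConformalSubmersion.inner_secondFormAt
    (hF : IsHorizontallyConformalSubmersion I I' F lam) (hN : 0 < Module.finrank ℝ E') {p : M}
    {s z : TangentSpace I p} (hs : s ∈ (vertical I I' F p)ᗮ) (hz : z ∈ (vertical I I' F p)ᗮ) :
    (inner ℝ (secondFormAt hF.smooth p s s) (mfderiv I I' F p z) : ℝ) =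
      mvfderiv I (fun q ↦ lam q ^ 2) p s * inner ℝ s z
        - mvfderiv I (fun q ↦ lam q ^ 2) p z * inner ℝ s s / 2 := by
  let S : Π x : M, TangentSpace I x := fun q ↦ horProj I I' F q (FiberBundle.extend E s q)
  let Z : Π x : M, TangentSpace I x := fun q ↦ horProj I I' F q (FiberBundle.extend E z q)
  have hS : MDiffAt (T% S) p := (hF.contMDiffAt_horProj hN
    (FiberBundle.contMDiffAt_extend I E s)).mdifferentiableAt (by simp)
  have hZ : MDiffAt (T% Z) p := (hF.contMDiffAt_horProj hN
    (FiberBundle.contMDiffAt_extend I E z)).mdifferentiableAt (by simp)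
  have hSp : S p = s := by simp only [S, FiberBundle.extend_apply_self, horProj_eq_self hs]
  have hZp : Z p = z := by simp only [Z, FiberBundle.extend_apply_self, horProj_eq_self hz]
  have hmu : MDiffAt (fun q ↦ lam q ^ 2) p := (hF.contMDiffAt_sq hN p).mdifferentiableAt (by simp)
  have hmet (X Y : Π x : M, TangentSpace I x) (hX : ∀ q, X q ∈ (vertical I I' F q)ᗮ) :
      (fun q ↦ (inner ℝ (mfderiv I I' F q (X q)) (mfderiv I I' F q (Y q)) : ℝ))
        = (fun q ↦ lam q ^ 2) * metricFun I X Y := by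
    funext q
    rw [hF.inner_mfderiv, horProj_eq_self (hX q)]
    rfl
  have hSS := mvfderiv_inner_along (mdifferentiableAt_mfderiv_field hF.smooth hS)
    (mdifferentiableAt_mfderiv_field hF.smooth hS) (Z p)
  have hSZ := mvfderiv_inner_along (mdifferentiableAt_mfderiv_field hF.smooth hS)
    (mdifferentiableAt_mfderiv_field hF.smooth hZ) (S p)
  rw [hmet S S (fun q ↦ horProj_mem F q _), mvfderiv_mul hmu (mdiffAt_metricFun hS hS), add_apply,
    smul_apply, smul_apply, metric_leviCivita hZ hS hS] at hSS
  rw [hmet S Z (fun q ↦ horProj_mem F q _), mvfderiv_mul hmu (mdiffAt_metricFun hS hZ), add_apply,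
    smul_apply, smul_apply, metric_leviCivita hS hS hZ] at hSZ
  have hbr := pullbackCov_sub hF.smooth hS hZ
  have htor := ((leviCivita I M).torsion_eq_zero_iff.1 torsion_leviCivita) hS hZ
  rw [← htor] at hbr
  have hbr' := congrArg (fun u ↦ (inner ℝ (mfderiv I I' F p (S p)) u : ℝ)) hbr
  simp only [inner_sub_right] at hbr'
  have hS1 (u : TangentSpace I p) : (inner ℝ (mfderiv I I' F p (S p)) (mfderiv I I' F p u) : ℝ)
      = lam p ^ 2 * inner ℝ (S p) u := by
    rw [hF.inner_mfderiv, horProj_eq_self (horProj_mem F p _)]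
  have hZ1 (u : TangentSpace I p) : (inner ℝ (mfderiv I I' F p u) (mfderiv I I' F p (Z p)) : ℝ)
      = lam p ^ 2 * inner ℝ u (Z p) := by
    rw [hF.inner_mfderiv, inner_horProj_left (horProj_mem F p _)]
  have hb := secondFormAt_apply hF.smooth hS hS
  rw [hSp] at hb
  rw [hb, secondFundamentalForm, ← hZp, ← hSp, inner_sub_left, hZ1]
  rw [hS1, inner_sub_right] at hbr'
  have c1 := real_inner_comm (S p) (leviCivita I M S p (Z p))
  have c2 := real_inner_comm (mfderiv I I' F p (S p))
    (pullbackCov I I' F (fun q ↦ mfderiv I I' F q (S q)) p (Z p))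
  simp only [smul_eq_mul, metricFun] at hSS hSZ
  linear_combination hSS / 2 - hSZ - hbr' - (lam p ^ 2 / 2) * c1 + c2 / 2

lemma pullbackCov_eq_zero {s : Π q : M, TangentSpace I' (F q)} {p : M}
    (hs : ∀ᶠ q in 𝓝 p, s q = 0) (hF : ContinuousAt F p) (v : TangentSpace I p) :
    pullbackCov I I' F s p v = 0 := by
  have hy := FiberBundle.mem_baseSet_trivializationAt' (F := E')
    (E := fun x : N ↦ TangentSpace I' x) (F p)
  set e := trivializationAt E' (fun x : N ↦ TangentSpace I' x) (F p)
  have h0 : coordAlong (I' := I') F p s =ᶠ[𝓝 p] fun _ ↦ (0 : E') := by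
    filter_upwards [hs, hF.eventually (e.open_baseSet.mem_nhds hy)] with q hq hqe
    rw [coordAlong, hq]
    exact (e.linear ℝ hqe).map_zero
  have h1 := mvfderiv_congr h0 v
  rw [mvfderiv_const] at h1
  have h2 : leviCivita I' N (FiberBundle.extend E' (s p)) (F p) (mfderiv I I' F p v) = 0 := by
    rw [hs.self_of_nhds]
    exact map_zero (covExtend (I' := I') (mfderiv I I' F p v))
  rw [pullbackCov, h2, add_zero]
  change e.symm (F p) (mvfderiv I (coordAlong (I' := I') F p s) p v) = 0
  rw [h1, ← e.symmL_apply (R := ℝ) hy]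
  exact map_zero _

lemma secondFormAt_vertical (hF : ContMDiff I I' ∞ F) {p : M} {V W : Π x : M, TangentSpace I x}
    (hV : MDiffAt (T% V) p) (hW : MDiffAt (T% W) p) (h : ∀ q, W q ∈ vertical I I' F q) :
    secondFormAt hF p (V p) (W p) = -mfderiv I I' F p (leviCivita I M W p (V p)) := by
  rw [secondFormAt_apply hF hV hW, secondFundamentalForm,
    pullbackCov_eq_zero (.of_forall fun q ↦ mem_vertical.1 (h q)) hF.continuous.continuousAt,
    zero_sub]

lemma IsHyperkahler.contMDiffAt_apply
    {R : Fin 3 → Π p : M, TangentSpace I p →L[ℝ] TangentSpace I p} (hR : IsHyperkahler I R)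
    (a : Fin 3) {p : M} {X : Π x : M, TangentSpace I x} (hX : CMDiffAt ∞ (T% X) p) :
    CMDiffAt ∞ (T% (fun q ↦ R a q (X q))) p :=
  ContMDiffAt.clm_bundle_apply (F₁ := E) (F₂ := E) (hR.smooth a).contMDiffAt hX

lemma secondFormAt_verProj {R : Fin 3 → Π p : M, TangentSpace I p →L[ℝ] TangentSpace I p}
    (hR : IsHyperkahler I R) (hF : IsHorizontallyConformalSubmersion I I' F lam)
    (hN : 0 < Module.finrank ℝ E') {a : Fin 3} (hω : OmegaParallel I I' F (R a)) {p : M}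
    {v w x : TangentSpace I p} (hv : v ∈ vertical I I' F p) (hw : w ∈ vertical I I' F p)
    (hx : x ∈ (vertical I I' F p)ᗮ)
    (hxb : mfderiv I I' F p x = secondFormAt hF.smooth p v w) :
    secondFormAt hF.smooth p v (verProj I I' F p (R a p w)) = mfderiv I I' F p (R a p x) := by
  obtain ⟨s, hs, hsv⟩ := FiberBundle.exists_contMDiffOn_extend (k := ∞) I E v
  obtain ⟨t, ht, htw⟩ := FiberBundle.exists_contMDiffOn_extend (k := ∞) I E w
  let U := interior (s ∩ t)
  have hpU : p ∈ U := mem_interior_iff_mem_nhds.2 (Filter.inter_mem hs ht)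
  let V : Π x : M, TangentSpace I x := fun q ↦ verProj I I' F q (FiberBundle.extend E v q)
  let W : Π x : M, TangentSpace I x := fun q ↦ verProj I I' F q (FiberBundle.extend E w q)
  have hVs (q) (hq : q ∈ U) : CMDiffAt ∞ (T% V) q := hF.contMDiffAt_verProj hN
    (hsv.contMDiffAt (Filter.mem_of_superset (isOpen_interior.mem_nhds hq)
      (interior_subset.trans Set.inter_subset_left)))
  have hWs (q) (hq : q ∈ U) : CMDiffAt ∞ (T% W) q := hF.contMDiffAt_verProj hN
    (htw.contMDiffAt (Filter.mem_of_superset (isOpen_interior.mem_nhds hq)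
      (interior_subset.trans Set.inter_subset_right)))
  have hVp : V p = v := by simp only [V, FiberBundle.extend_apply_self, verProj_eq_self hv]
  have hWp : W p = w := by simp only [W, FiberBundle.extend_apply_self, verProj_eq_self hw]
  have hVd := (hVs p hpU).mdifferentiableAt (n := ∞) (by simp)
  have hWd := (hWs p hpU).mdifferentiableAt (n := ∞) (by simp)
  have hpar := hω U isOpen_interior V W
    ⟨fun q hq ↦ (hVs q hq).contMDiffWithinAt, fun q _ ↦ verProj_mem F q _⟩
    ⟨fun q hq ↦ (hWs q hq).contMDiffWithinAt, fun q _ ↦ verProj_mem F q _⟩ p hpU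
  have hRW := hR.contMDiffAt_apply a (hWs p hpU)
  let P : Π x : M, TangentSpace I x := fun q ↦ verProj I I' F q (R a q (W q))
  have hP : MDiffAt (T% P) p := (hF.contMDiffAt_verProj hN hRW).mdifferentiableAt (by simp)
  have hO : MDiffAt (T% (omega I I' F (R a) W)) p :=
    (hF.contMDiffAt_horProj hN hRW).mdifferentiableAt (by simp)
  have hsum : (fun q ↦ R a q (W q)) = P + omega I I' F (R a) W := by
    funext q
    exact (verProj_add_horProj F q _).symm
  have hRpar := hR.parallel a U isOpen_interior W
    (fun q hq ↦ (hWs q hq).contMDiffWithinAt) p hpU (V p)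
  rw [hsum, (leviCivita I M).isCovariantDerivativeOnUniv.add hP hO, add_apply] at hRpar
  have hb := secondFormAt_vertical hF.smooth hVd hWd (fun q ↦ verProj_mem F q _)
  have hb' := secondFormAt_vertical hF.smooth hVd hP (fun q ↦ verProj_mem F q _)
  have hPp : P p = verProj I I' F p (R a p w) := by simp only [P, hWp]
  rw [hPp, hVp] at hb'
  rw [hVp, hWp, ← hxb] at hb
  rw [hb']
  have hx' : x = -horProj I I' F p (leviCivita I M W p v) := by
    have h1 : x + leviCivita I M W p v ∈ vertical I I' F p := by
      rw [mem_vertical, map_add, hb, neg_add_cancel]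
    have h2 := horProj_eq_zero h1
    rw [map_add, horProj_eq_self hx] at h2
    exact eq_neg_of_add_eq_zero_left h2
  rw [covOmega, sub_eq_zero, hVp] at hpar
  have h3 := congrArg (mfderiv I I' F p) hpar
  rw [omega, mfderiv_horProj, mfderiv_horProj] at h3
  rw [hVp] at hRpar h3
  have h4 := congrArg (mfderiv I I' F p) hRpar
  have h5 := congrArg (fun u ↦ mfderiv I I' F p (R a p u))
    (verProj_add_horProj (I' := I') F p (leviCivita I M W p v))
  simp only [map_add] at h5
  rw [map_add, h3, ← h5, add_comm] at h4
  rw [hx', map_neg, map_neg, add_left_cancel h4]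

/-! ### The fibres of a slant submersion with parallel `ω_R` are minimal -/

lemma IsHyperkahler.inner_apply_left
    {R : Fin 3 → Π p : M, TangentSpace I p →L[ℝ] TangentSpace I p} (hR : IsHyperkahler I R)
    (a : Fin 3) {p : M} (v w : TangentSpace I p) :
    (inner ℝ (R a p v) w : ℝ) = -inner ℝ v (R a p w) := by
  rw [← hR.isometry a p (R a p v) w, hR.sq, inner_neg_left]

lemma norm_starProjection_of_angle {T : Type*} [NormedAddCommGroup T] [InnerProductSpace ℝ T]
    (K : Submodule ℝ T) [K.HasOrthogonalProjection] {v : T} (hv : v ≠ 0)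
    (h : angleToSubspace K v < Real.pi / 2) :
    ‖K.starProjection v‖ = Real.cos (angleToSubspace K v) * ‖v‖ := by
  have h0 : K.starProjection v ≠ 0 := by
    intro h0
    rw [angleToSubspace, h0, InnerProductGeometry.angle_zero_right] at h
    exact lt_irrefl _ h
  have h1 : (inner ℝ v (K.starProjection v) : ℝ) = ‖K.starProjection v‖ ^ 2 := by
    rw [← real_inner_self_eq_norm_sq]
    have h2 := K.starProjection_inner_eq_zero v _ (K.starProjection_apply_mem v)
    rw [inner_sub_left] at h2
    linarith
  rw [angleToSubspace, InnerProductGeometry.cos_angle, h1]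
  field_simp

variable {R : Fin 3 → Π p : M, TangentSpace I p →L[ℝ] TangentSpace I p} {θ : Fin 3 → ℝ}

lemma IsAlmostHConformalSlant.norm_verProj (hR : IsHyperkahler I R)
    (hF : IsAlmostHConformalSlant I I' F lam R θ) {a : Fin 3} (hθ : θ a < Real.pi / 2) {p : M}
    {v : TangentSpace I p} (hv : v ∈ vertical I I' F p) :
    ‖verProj I I' F p (R a p v)‖ = Real.cos (θ a) * ‖v‖ := by
  rcases eq_or_ne v 0 with rfl | h0
  · simp
  have hn : ‖R a p v‖ = ‖v‖ := by
    rw [← sq_eq_sq₀ (norm_nonneg _) (norm_nonneg _), ← real_inner_self_eq_norm_sq,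
      ← real_inner_self_eq_norm_sq, hR.isometry]
  have hne : R a p v ≠ 0 := by rwa [← norm_ne_zero_iff, hn, norm_ne_zero_iff]
  have hs := hF.slant a p v hv h0
  have := norm_starProjection_of_angle (vertical I I' F p) hne (by rwa [hs])
  rwa [hs, hn] at this

variable (I') in
/-- `φ_R`, the vertical part of `R`, as an endomorphism of the vertical space. -/
def slantMap (F : M → N)
    (R : Π p : M, TangentSpace I p →L[ℝ] TangentSpace I p) (p : M) :
    vertical I I' F p →ₗ[ℝ] vertical I I' F p :=
  LinearMap.codRestrict (vertical I I' F p)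
    (((verProj I I' F p).comp (R p)).toLinearMap.comp (vertical I I' F p).subtype)
    (fun _ ↦ verProj_mem F p _)

lemma coe_slantMap (F : M → N) (R : Π p : M, TangentSpace I p →L[ℝ] TangentSpace I p) (p : M)
    (v : vertical I I' F p) :
    (slantMap I' F R p v : TangentSpace I p) = verProj I I' F p (R p v) := rfl

lemma IsAlmostHConformalSlant.inner_slantMap (hR : IsHyperkahler I R)
    (hF : IsAlmostHConformalSlant I I' F lam R θ) {a : Fin 3} (hθ : θ a < Real.pi / 2) {p : M}
    (v w : vertical I I' F p) :
    (inner ℝ (slantMap I' F (R a) p v) (slantMap I' F (R a) p w) : ℝ)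
      = Real.cos (θ a) ^ 2 * inner ℝ v w := by
  have hn (u : vertical I I' F p) : ‖slantMap I' F (R a) p u‖ = Real.cos (θ a) * ‖u‖ :=
    hF.norm_verProj hR hθ u.2
  rw [real_inner_eq_norm_add_mul_self_sub_norm_mul_self_sub_norm_mul_self_div_two,
    real_inner_eq_norm_add_mul_self_sub_norm_mul_self_sub_norm_mul_self_div_two, ← map_add,
    hn, hn, hn]
  ring

lemma IsAlmostHConformalSlant.slantMap_slantMap (hR : IsHyperkahler I R)
    (hF : IsAlmostHConformalSlant I I' F lam R θ) {a : Fin 3} (hθ : θ a < Real.pi / 2) {p : M}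
    (v : vertical I I' F p) :
    slantMap I' F (R a) p (slantMap I' F (R a) p v) = (-Real.cos (θ a) ^ 2) • v := by
  refine ext_inner_right ℝ fun w ↦ ?_
  have h := hF.inner_slantMap hR hθ v w
  rw [Submodule.coe_inner, Submodule.coe_inner, Submodule.coe_smul, real_inner_smul_left, neg_mul,
    ← Submodule.coe_inner (vertical I I' F p) v w, ← h, Submodule.coe_inner, coe_slantMap,
    inner_verProj_left w.2, hR.inner_apply_left, coe_slantMap F (R a) p w,
    real_inner_comm (verProj I I' F p (R a p w) : TangentSpace I p) _, inner_verProj_left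
    (slantMap I' F (R a) p v).2, real_inner_comm]

/-- If `ω_R` is parallel and the slant angle is acute, the fibres are minimal. -/
lemma IsAlmostHConformalSlant.sum_vertical_eq_zero (hR : IsHyperkahler I R)
    (hF : IsAlmostHConformalSlant I I' F lam R θ) (hN : 0 < Module.finrank ℝ E') {a : Fin 3}
    (hω : OmegaParallel I I' F (R a)) (hθ0 : 0 ≤ θ a) (hθ : θ a < Real.pi / 2) {p : M}
    {ι : Type*} [Fintype ι] (e : OrthonormalBasis ι ℝ (vertical I I' F p)) :
    ∑ i, secondFormAt hF.conformal.smooth p (e i) (e i) = 0 := by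
  have hc : 0 < Real.cos (θ a) :=
    Real.cos_pos_of_mem_Ioo ⟨by linarith [Real.pi_pos], hθ⟩
  set b := secondFormAt hF.conformal.smooth p
  set φ := slantMap I' F (R a) p
  have key (v : vertical I I' F p) : b (φ v) (φ v) = (-Real.cos (θ a) ^ 2) • b v v := by
    have lift (y : TangentSpace I' (F p)) :
        ∃ x ∈ (vertical I I' F p)ᗮ, mfderiv I I' F p x = y := by
      obtain ⟨u, hu⟩ := hF.conformal.surjective p y
      exact ⟨horProj I I' F p u, horProj_mem F p u, by rw [mfderiv_horProj, hu]⟩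
    obtain ⟨y, hy, hyb⟩ := lift (b v (φ v))
    have h1 := secondFormAt_verProj hR hF.conformal hN hω v.2 (φ v).2 hy hyb
    have hyb' : mfderiv I I' F p y = b (φ v) v := by
      rw [hyb]; exact secondFormAt_comm _ _ _
    have h2 := secondFormAt_verProj hR hF.conformal hN hω (φ v).2 v.2 hy hyb'
    have h3 : (verProj I I' F p (R a p (φ v)) : TangentSpace I p)
        = (((-Real.cos (θ a) ^ 2) • v : vertical I I' F p) : TangentSpace I p) := by
      rw [← hF.slantMap_slantMap hR hθ v]; rfl
    rw [← h1, h3, Submodule.coe_smul, map_smul] at h2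
    exact h2
  let U : vertical I I' F p →ₗᵢ[ℝ] vertical I I' F p :=
    { toLinearMap := (Real.cos (θ a))⁻¹ • φ
      norm_map' := fun v ↦ by
        have hn : ‖φ v‖ = Real.cos (θ a) * ‖v‖ := hF.norm_verProj hR hθ v.2
        rw [LinearMap.smul_apply, norm_smul, hn, Real.norm_of_nonneg (inv_nonneg.2 hc.le),
          inv_mul_cancel_left₀ hc.ne'] }
  have hU (v : vertical I I' F p) : b (U v) (U v) = -b v v := by
    have hUv : ((U v : vertical I I' F p) : TangentSpace I p)
      = (Real.cos (θ a))⁻¹ • (φ v : TangentSpace I p) := rfl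
    have hcc : (Real.cos (θ a))⁻¹ * ((Real.cos (θ a))⁻¹ * Real.cos (θ a) ^ 2) = 1 := by
      field_simp
    simp only [hUv, map_smul, LinearMap.smul_apply, key, neg_smul, smul_neg, smul_smul, hcc,
      one_smul]
  have hsum := sum_orthonormalBasis_eq (b.domRestrict₁₂ (vertical I I' F p) (vertical I I' F p)) e
    (e.map (U.toLinearIsometryEquiv rfl))
  simp only [LinearMap.domRestrict₁₂_apply, OrthonormalBasis.map_apply,
    LinearIsometry.coe_toLinearIsometryEquiv, hU, Finset.sum_neg_distrib] at hsum
  have h2 : (2 : ℝ) • ∑ i, b (e i) (e i) = 0 := by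
    rw [two_smul]
    nth_rewrite 1 [hsum]
    exact neg_add_cancel _
  calc ∑ i, b (e i) (e i) = (2 : ℝ)⁻¹ • (2 : ℝ) • ∑ i, b (e i) (e i) := by
        rw [smul_smul, inv_mul_cancel₀ two_ne_zero, one_smul]
    _ = 0 := by rw [h2, smul_zero]

/-- The tension field of a horizontally conformal submersion with minimal fibres. -/
lemma IsHorizontallyConformalSubmersion.inner_tensionField
    (hF : IsHorizontallyConformalSubmersion I I' F lam) (hN : 0 < Module.finrank ℝ E') {p : M}
    (hmin : ∑ i, secondFormAt hF.smooth p (stdOrthonormalBasis ℝ (vertical I I' F p) i)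
      (stdOrthonormalBasis ℝ (vertical I I' F p) i) = 0)
    {z : TangentSpace I p} (hz : z ∈ (vertical I I' F p)ᗮ) :
    (inner ℝ (tensionField I I' F p) (mfderiv I I' F p z) : ℝ) =
      (1 - (Module.finrank ℝ E' : ℝ) / 2) * mvfderiv I (fun q ↦ lam q ^ 2) p z := by
  let v := stdOrthonormalBasis ℝ (vertical I I' F p)
  let h := stdOrthonormalBasis ℝ (vertical I I' F p)ᗮ
  let e := (v.prod h).map (vertical I I' F p).orthogonalDecomposition.symm
  have hfr : Module.finrank ℝ (vertical I I' F p)ᗮ = Module.finrank ℝ E' := by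
    have h1 := (vertical I I' F p).finrank_add_finrank_orthogonal
    have h2 := LinearMap.finrank_range_add_finrank_ker
      (mfderiv I I' F p : TangentSpace I p →ₗ[ℝ] TangentSpace I' (F p))
    rw [LinearMap.range_eq_top.2 (hF.surjective p), finrank_top] at h2
    have h3 : Module.finrank ℝ (TangentSpace I' (F p)) = Module.finrank ℝ E' := rfl
    have h4 : Module.finrank ℝ (LinearMap.ker
      (mfderiv I I' F p : TangentSpace I p →ₗ[ℝ] TangentSpace I' (F p)))
      = Module.finrank ℝ (vertical I I' F p) := rfl
    omega
  rw [tensionField_eq_sum hF.smooth e, Fintype.sum_sum_type]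
  have hl (i) : e (Sum.inl i) = v i := by simp [e]
  have hr (i) : e (Sum.inr i) = h i := by simp [e]
  simp only [hl, hr]
  rw [hmin, zero_add, sum_inner]
  have hone (i) : (inner ℝ (h i : TangentSpace I p) (h i : TangentSpace I p) : ℝ) = 1 := by
    rw [← Submodule.coe_inner, real_inner_self_eq_norm_sq, h.norm_eq_one, one_pow]
  simp only [hF.inner_secondFormAt hN (h _).2 hz, hone]
  rw [Finset.sum_sub_distrib]
  have hexp : ∑ i, mvfderiv I (fun q ↦ lam q ^ 2) p (h i) * inner ℝ (h i : TangentSpace I p) z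
      = mvfderiv I (fun q ↦ lam q ^ 2) p z := by
    have h5 := congrArg (fun u : (vertical I I' F p)ᗮ ↦
      mvfderiv I (fun q ↦ lam q ^ 2) p (u : TangentSpace I p)) (h.sum_repr' ⟨z, hz⟩)
    simp only [Submodule.coe_sum, Submodule.coe_smul, map_sum, map_smul, Submodule.coe_inner,
      smul_eq_mul] at h5
    rw [← h5]
    exact Finset.sum_congr rfl fun i _ ↦ mul_comm _ _
  rw [hexp, Finset.sum_const, Finset.card_univ, Fintype.card_fin, hfr]
  simp only [nsmul_eq_mul]
  ring

lemma IsHorizontallyConformalSubmersion.tensionField_eq_zero_iff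
    (hF : IsHorizontallyConformalSubmersion I I' F lam) (hN : 2 < Module.finrank ℝ E') {p : M}
    (hmin : ∑ i, secondFormAt hF.smooth p (stdOrthonormalBasis ℝ (vertical I I' F p) i)
      (stdOrthonormalBasis ℝ (vertical I I' F p) i) = 0) :
    tensionField I I' F p = 0 ↔ ∀ z ∈ (vertical I I' F p)ᗮ,
      mvfderiv I (fun q ↦ lam q ^ 2) p z = 0 := by
  have hn : (1 - (Module.finrank ℝ E' : ℝ) / 2) ≠ 0 := by
    have : (2 : ℝ) < Module.finrank ℝ E' := by exact_mod_cast hN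
    intro h; linarith
  refine ⟨fun h z hz ↦ ?_, fun h ↦ ?_⟩
  · have := hF.inner_tensionField (by omega) hmin hz
    rw [h, inner_zero_left] at this
    exact (mul_eq_zero.1 this.symm).resolve_left hn
  · refine ext_inner_right ℝ fun y ↦ ?_
    obtain ⟨u, rfl⟩ := hF.surjective p y
    rw [← mfderiv_horProj, hF.inner_tensionField (by omega) hmin (horProj_mem F p u),
      h _ (horProj_mem F p u), mul_zero, inner_zero_left]

end Tension

end HSlant

end

theorem corollary3p14
    {E : Type*} [NormedAddCommGroup E] [NormedSpace ℝ E] [FiniteDimensional ℝ E]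
    {H : Type*} [TopologicalSpace H] (I : ModelWithCorners ℝ E H) [I.Boundaryless]
    {M : Type*} [TopologicalSpace M] [ChartedSpace H M] [IsManifold I ∞ M]
    [RiemannianBundle (fun x : M ↦ TangentSpace I x)]
    [IsContMDiffRiemannianBundle I ∞ E (fun x : M ↦ TangentSpace I x)]
    {E' : Type*} [NormedAddCommGroup E'] [NormedSpace ℝ E'] [FiniteDimensional ℝ E']
    {H' : Type*} [TopologicalSpace H'] (I' : ModelWithCorners ℝ E' H') [I'.Boundaryless]
    {N : Type*} [TopologicalSpace N] [ChartedSpace H' N] [IsManifold I' ∞ N]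
    [RiemannianBundle (fun x : N ↦ TangentSpace I' x)]
    [IsContMDiffRiemannianBundle I' ∞ E' (fun x : N ↦ TangentSpace I' x)]
    (R : Fin 3 → Π p : M, TangentSpace I p →L[ℝ] TangentSpace I p)
    (hR : HSlant.IsHyperkahler I R)
    (F : M → N) (lam : M → ℝ) (θ : Fin 3 → ℝ)
    (hF : HSlant.IsAlmostHConformalSlant I I' F lam R θ)
    (hN : 2 < Module.finrank ℝ E')
    (hω : ∃ a, HSlant.OmegaParallel I I' F (R a) ∧ 0 ≤ θ a ∧ θ a < Real.pi / 2) :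
    HSlant.IsHarmonic I I' F ↔ HSlant.IsHorizontallyHomothetic I I' F lam := by
  obtain ⟨a, hpar, hθ0, hθ⟩ := hω
  rw [hF.conformal.isHorizontallyHomothetic_iff (by omega)]
  exact forall_congr' fun p ↦ hF.conformal.tensionField_eq_zero_iff hN
    (hF.sum_vertical_eq_zero hR (by omega) hpar hθ0 hθ _)
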